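/- For tempered distributions on $\mathbb R^2$ use the Fourier transform normalized by $\widehat\varphi(\xi,\eta)=(2\pi)^{-1}\int_{\mathbb R^2}\varphi(x,y)e^{i(x\xi+y\eta)}\,dx\,dy$. For $s_1,s_2\in\mathbb R$ and $r\in\mathbb N$ let $\mathcal F^{s_1,s_2}_{r,0}$ be the space of all $\varphi\in L^2(\mathbb R^2)$ (complex-valued) for which $$\|\varphi\|_{\mathcal F^{s_1,s_2}_{r,0}}^2=\big\|(1+|\xi|^{s_1}+|\eta|^{s_2})\widehat\varphi\big\|_{L^2}^2+\big\|(|x|^{r}+1)\varphi\big\|_{L^2}^2$$ is finite. Let $A=\partial_x(1+\mathcal H\partial_x)^{-1}\partial_{yy}$, where $\mathcal H$ is the Hilbert transform in $x$, normalized so that $\mathcal H\partial_x$ has Fourier symbol $|\xi|$, and let $E(t)=e^{tA}$, that is, $\widehat{E(t)\varphi}(\xi,\eta)=e^{it\xi\eta^2/(1+|\xi|)}\,\widehat\varphi(\xi,\eta)$ for $\varphi \in L^2(\mathbb R^2)$. Let $r\ge 1$ be an integer. 1. If $r=1$ or $r=2$, there is a polynomial $P_r$ of degree $r$ with positive coefficients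 (depending only on $r$) such that for all $s_1,s_2\in\mathbb R$ with $s_2\ge 2r$, all $\varphi\in\mathcal F^{s_1,s_2}_{r,0}$ and all $t\ge 0$, one has $E(t)\varphi\in\mathcal F^{s_1,s_2}_{r,0}$ and $$\|E(t)\varphi\|_{\mathcal F^{s_1,s_2}_{r,0}}\le P_r(t)\,\|\varphi\|_{\mathcal F^{s_1,s_2}_{r,0}}.$$ 2. If $r\ge 3$, $s_1,s_2\in\mathbb R$, $s_2\ge 2r$ and $\varphi\in\mathcal F^{s_1,s_2}_{r,0}$, then $\widehat\varphi$ has a representative for which $\xi\mapsto\widehat\varphi(\xi,\eta)$ is of class $C^{r-3}$ for almost every $\eta$, and for any such representative $E(t)\varphi\in C([0,\infty);\mathcal F^{s_1,s_2}_{r,0})$ (that is, $E(t)\varphi\in\mathcal F^{s_1,s_2}_{r,0}$ for every $t\ge0$, and $t\mapsto E(t)\varphi$ is continuous on $[0,\infty)$ in the norm of this space) if and only if $$\partial_\xi^j\widehat\varphi(0,\eta)=0\quad\text{for almost every }\eta\in\mathbb R\text{ and all }j=0,1,\dots,r-3 .$$ -/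

import Mathlib

open MeasureTheory Filter
open scoped FourierTransform Topology ENNReal

noncomputable section

namespace RZKBO

/-- The plane, with coordinates `x = p 0` and `y = p 1`. -/
abbrev Plane : Type := EuclideanSpace ℝ (Fin 2)

/-- Complex-valued square-integrable functions on the plane. -/
abbrev L2 : Type := Lp ℂ 2 (volume : Measure Plane)

/-! ### Frequency variables

The Fourier transform used in the text is
`φ̂(ξ, η) = (2π)⁻¹ ∫ φ(x, y) e^{i(xξ + yη)} dx dy`, while Mathlib's is
`𝓕 φ(ζ) = ∫ φ(p) e^{-2πi⟨p, ζ⟩} dp`.  Hence, with `ξ = -2π ζ₀` and `η = -2π ζ₁`,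
`φ̂(ξ, η) = (2π)⁻¹ 𝓕 φ(ζ)`.  All symbols and weights below are written in terms of
`ξ = xi ζ` and `η = eta ζ`. -/

/-- The frequency `ξ` dual to `x`. -/
def xi (ζ : Plane) : ℝ := -(2 * Real.pi) * ζ 0

/-- The frequency `η` dual to `y`. -/
def eta (ζ : Plane) : ℝ := -(2 * Real.pi) * ζ 1

/-- `hat φ ζ = φ̂(ξ, η)` with `ξ = xi ζ`, `η = eta ζ` (defined almost everywhere). -/
def hat (φ : L2) (ζ : Plane) : ℂ := ((2 * Real.pi : ℝ) : ℂ)⁻¹ * (𝓕 φ : L2) ζ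

/-! ### The symbol of `A = ∂ₓ (1 + 𝓗 ∂ₓ)⁻¹ ∂_yy` and the group `E(t) = e^{tA}` -/

/-- Symbol of `∂ₓ`. -/
def symDx (ζ : Plane) : ℂ := -(Complex.I * (xi ζ : ℂ))

/-- Symbol of `∂_y`. -/
def symDy (ζ : Plane) : ℂ := -(Complex.I * (eta ζ : ℂ))

/-- Symbol of the Hilbert transform in `x`, normalized so that `𝓗 ∂ₓ` has symbol `|ξ|`. -/
def symHilbert (ζ : Plane) : ℂ := Complex.I * ((SignType.sign (xi ζ) : ℝ) : ℂ)

/-- Symbol of `A = ∂ₓ (1 + 𝓗 ∂ₓ)⁻¹ ∂_yy`. -/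
def symA (ζ : Plane) : ℂ :=
  symDx ζ * (1 + symHilbert ζ * symDx ζ)⁻¹ * symDy ζ ^ 2

theorem symHilbert_mul_symDx (ζ : Plane) : symHilbert ζ * symDx ζ = ((|xi ζ| : ℝ) : ℂ) := by
  have h : ((SignType.sign (xi ζ) : ℝ)) * xi ζ = |xi ζ| := sign_mul_self (xi ζ)
  rw [← h, symHilbert, symDx]
  push_cast
  linear_combination
    (-(((SignType.sign (xi ζ) : ℝ) : ℂ) * (xi ζ : ℂ))) * Complex.I_mul_I

/-- `A` has symbol `i ξ η² / (1 + |ξ|)`. -/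
theorem symA_eq (ζ : Plane) :
    symA ζ = ((xi ζ * eta ζ ^ 2 / (1 + |xi ζ|) : ℝ) : ℂ) * Complex.I := by
  rw [symA, symHilbert_mul_symDx, symDx, symDy]
  push_cast
  rw [div_eq_mul_inv]
  linear_combination (-(Complex.I * (xi ζ : ℂ) * (1 + ((|xi ζ| : ℝ) : ℂ))⁻¹
    * (eta ζ : ℂ) ^ 2)) * Complex.I_mul_I

/-- Symbol of `E(t) = e^{tA}`. -/
def symE (t : ℝ) (ζ : Plane) : ℂ := Complex.exp ((t : ℂ) * symA ζ)

theorem norm_symE (t : ℝ) (ζ : Plane) : ‖symE t ζ‖ = 1 := by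
  have h : (t : ℂ) * symA ζ
      = ((t * (xi ζ * eta ζ ^ 2 / (1 + |xi ζ|)) : ℝ) : ℂ) * Complex.I := by
    rw [symA_eq]; push_cast; ring
  rw [symE, h, Complex.norm_exp_ofReal_mul_I]

theorem continuous_symE (t : ℝ) : Continuous (symE t) := by
  have h1 : Continuous xi := by unfold xi; fun_prop
  have h2 : Continuous eta := by unfold eta; fun_prop
  have h3 : Continuous fun ζ => xi ζ * eta ζ ^ 2 / (1 + |xi ζ|) :=
    (h1.mul (h2.pow 2)).div (by fun_prop) fun ζ => by positivity
  have h4 : symE t = fun ζ => Complex.exp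
      ((t : ℂ) * (((xi ζ * eta ζ ^ 2 / (1 + |xi ζ|) : ℝ) : ℂ) * Complex.I)) := by
    funext ζ; rw [symE, symA_eq]
  rw [h4]
  fun_prop

theorem memLp_symE_mul (t : ℝ) (g : L2) :
    MemLp (fun ζ => symE t ζ * g ζ) 2 (volume : Measure Plane) :=
  (Lp.memLp g).of_le
    ((continuous_symE t).aestronglyMeasurable.mul (Lp.aestronglyMeasurable g))
    (Eventually.of_forall fun ζ => by rw [norm_mul, norm_symE, one_mul])

/-- The group `E(t) = e^{tA}` on `L²`: the Fourier multiplier with symbol `e^{t symA}`. -/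
def E (t : ℝ) (φ : L2) : L2 := 𝓕⁻ ((memLp_symE_mul t (𝓕 φ : L2)).toLp)

theorem fourier_E (t : ℝ) (φ : L2) :
    (𝓕 (E t φ) : L2) =ᵐ[volume] fun ζ => symE t ζ * (𝓕 φ : L2) ζ := by
  rw [E, FourierTransform.fourier_fourierInv_eq]
  exact MemLp.coeFn_toLp _

theorem E_zero (φ : L2) : E 0 φ = φ := by
  have h : (memLp_symE_mul 0 (𝓕 φ : L2)).toLp = 𝓕 φ := by
    apply Lp.ext
    filter_upwards [(memLp_symE_mul 0 (𝓕 φ : L2)).coeFn_toLp] with ζ hζ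
    rw [hζ]; simp [symE]
  rw [E, h, FourierTransform.fourierInv_fourier_eq]

theorem E_add (s t : ℝ) (φ : L2) : E (s + t) φ = E s (E t φ) := by
  have h : (memLp_symE_mul (s + t) (𝓕 φ : L2)).toLp
      = (memLp_symE_mul s (𝓕 (E t φ) : L2)).toLp := by
    apply Lp.ext
    filter_upwards [(memLp_symE_mul (s + t) (𝓕 φ : L2)).coeFn_toLp,
      (memLp_symE_mul s (𝓕 (E t φ) : L2)).coeFn_toLp, fourier_E t φ] with ζ h1 h2 h3
    rw [h1, h2, h3, symE, symE, symE, ← mul_assoc, ← Complex.exp_add]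
    push_cast
    ring_nf
  exact congrArg (fun g : L2 => (𝓕⁻ g : L2)) h

/-! ### Weighted anisotropic Sobolev spaces -/

/-- The Fourier weight `1 + |ξ|^{s₁} + |η|^{s₂}` of the anisotropic Sobolev space. -/
def sobolevWeight (s₁ s₂ : ℝ) (ζ : Plane) : ℝ := 1 + |xi ζ| ^ s₁ + |eta ζ| ^ s₂

/-- Membership in `H^{s₁,s₂}`, i.e. `(1 + |ξ|^{s₁} + |η|^{s₂}) φ̂ ∈ L²`.  As the weight is at least
one, every tempered distribution with this property is in `L²`, so it is enough to consider
`φ ∈ L²`. -/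
def MemH (s₁ s₂ : ℝ) (φ : L2) : Prop :=
  MemLp (fun ζ => (sobolevWeight s₁ s₂ ζ : ℂ) * (𝓕 φ : L2) ζ) 2 (volume : Measure Plane)

/-- The norm of `H^{s₁,s₂}`: the `L²(dξ dη)` norm of `(1 + |ξ|^{s₁} + |η|^{s₂}) φ̂(ξ, η)`.  (The
Jacobian of `ζ ↦ (ξ, η)` cancels the factor `(2π)⁻¹` in `hat`.) -/
def normH (s₁ s₂ : ℝ) (φ : L2) : ℝ :=
  (eLpNorm (fun ζ => (sobolevWeight s₁ s₂ ζ : ℂ) * (𝓕 φ : L2) ζ) 2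
    (volume : Measure Plane)).toReal

/-- Membership in `L²_{r₁,r₂}`, i.e. `(|x|^{r₁} + |y|^{r₂}) φ ∈ L²` (for `φ ∈ L²`). -/
def MemWeighted (r₁ r₂ : ℝ) (φ : L2) : Prop :=
  MemLp (fun p => ((|p 0| ^ r₁ + |p 1| ^ r₂ : ℝ) : ℂ) * φ p) 2 (volume : Measure Plane)

/-- The norm of `L²_{r₁,r₂}`. -/
def normWeighted (r₁ r₂ : ℝ) (φ : L2) : ℝ :=
  (eLpNorm (fun p => ((|p 0| ^ r₁ + |p 1| ^ r₂ : ℝ) : ℂ) * φ p) 2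
    (volume : Measure Plane)).toReal

/-- Membership in `𝓕^{s₁,s₂}_{r₁,r₂} = H^{s₁,s₂} ∩ L²_{r₁,r₂}`. -/
def MemF (s₁ s₂ r₁ r₂ : ℝ) (φ : L2) : Prop := MemH s₁ s₂ φ ∧ MemWeighted r₁ r₂ φ

/-- The norm of `𝓕^{s₁,s₂}_{r₁,r₂}`. -/
def normF (s₁ s₂ r₁ r₂ : ℝ) (φ : L2) : ℝ :=
  Real.sqrt (normH s₁ s₂ φ ^ 2 + normWeighted r₁ r₂ φ ^ 2)

/-- `u ∈ C([0,∞); 𝓕^{s₁,s₂}_{r₁,r₂})`: the curve takes its values in the space on `[0,∞)` and is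
continuous there for the norm of the space. -/
def IsContinuousCurve (s₁ s₂ r₁ r₂ : ℝ) (u : ℝ → L2) : Prop :=
  (∀ t, 0 ≤ t → MemF s₁ s₂ r₁ r₂ (u t)) ∧
    ∀ t₀, 0 ≤ t₀ →
      Tendsto (fun t => normF s₁ s₂ r₁ r₂ (u t - u t₀)) (𝓝[Set.Ici 0] t₀) (𝓝 0)

/-! ### Derivatives of `φ̂` on the line `ξ = 0` -/

/-- `h` is a representative of `φ̂` such that `ξ ↦ h ξ η` is of class `C^k` for almost every `η`.
Two such representatives have, for almost every `η`, the same restriction to the line with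
ordinate `η`, so that `∂_ξ^j φ̂(0, η) = iteratedDeriv j (fun ξ => h ξ η) 0`, `j ≤ k`, is determined
by `φ` for almost every `η`. -/
def IsFiberwiseRep (k : ℕ) (φ : L2) (h : ℝ → ℝ → ℂ) : Prop :=
  (fun ζ => h (xi ζ) (eta ζ)) =ᵐ[(volume : Measure Plane)] hat φ ∧
    ∀ᵐ η : ℝ, ContDiff ℝ k (fun ξ => h ξ η)

end RZKBO

end

noncomputable section

namespace RZKBO

open Finset.HasAntidiagonal (antidiagonal mem_antidiagonal)

/-! ### Primitives on the line -/

/-! Under the Fourier transform the weight `|x|^r` becomes the demand that `φ̂` have `r` weak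
derivatives in `ξ` that lie in L². The group multiplies `φ̂` by a unimodular symbol, which on a
horizontal line, with `a = ζ 0`, reads `exp (α a / (1 + 2π|a|))`, where `α = -2π i t η²`. The
Sobolev part of the norm is therefore invariant, and everything turns on the regularity of this
symbol in `a`.

On each half-line the symbol is smooth, and its `k`-th derivative is the symbol times a polynomial
in `w = (1 + 2π|a|)⁻¹`, of size at most a constant times `((1 + t)(1 + η²))^k`. At `a = 0` the
one-sided derivatives of order 0 and 1 agree, while those of order 2 differ by `-8πα`
(`dExp_two_sub`). Hence the two one-sided Leibniz formulas for the derivatives of the product, of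
orders below `r`, match at the origin as soon as `∂_ξ^j φ̂(0, η) = 0` for `j ≤ r - 3`, which is no
condition when `r ≤ 2`; if `α ≠ 0` they match only then (`leibniz_match_of_vanish`,
`vanish_of_leibniz_match`).

Sufficiency: matching formulas glue to a chain of weak derivatives (`IsXiChain.leibnizE_chain`). Its
terms are controlled by `(1 + η²)^i ∂_ξ^j φ̂` with `i + j ≤ r`, which interpolate between `(1 +
η²)^r φ̂`, bounded because `s₂ ≥ 2r`, and `∂_ξ^r φ̂` (`IsXiChain.lintegral_lam_pow`). This gives the
growth `(1 + t)^r`, and dominated convergence gives continuity in time.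

Necessity: if `E 1 φ` lies in the weighted space, then on almost every line the one-sided formulas
both coincide with the continuous derivatives of its transform, so they match at the origin
(`vanish_of_chain`).

Weak derivatives are taken as primitives on almost every line. Their equivalence with multiplication
by `x` (`hasXiDeriv_fourier`, `fourierInv_xiDeriv`) rests on the resolvent `(1 - xMul)⁻¹`. -/

theorem absolutelyContinuousOnInterval_integral {f : ℝ → ℂ} {a b : ℝ}
    (h : IntervalIntegrable f volume a b) :
    AbsolutelyContinuousOnInterval (fun x => ∫ s in a..x, f s) a b := by
  have hre : IntervalIntegrable (fun s => (f s).re) volume a b :=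
    ⟨h.1.re, h.2.re⟩
  have him : IntervalIntegrable (fun s => (f s).im) volume a b :=
    ⟨h.1.im, h.2.im⟩
  have hc (z : ℂ) : AbsolutelyContinuousOnInterval (fun _ : ℝ => z) a b :=
    LipschitzOnWith.absolutelyContinuousOnInterval (K := 0)
      ((LipschitzWith.const z).lipschitzOnWith)
  have h1 := ((hre.absolutelyContinuousOnInterval_intervalIntegral
    (c := a) (by simp)).smul (hc 1)).add
    ((him.absolutelyContinuousOnInterval_intervalIntegral (c := a) (by simp)).smul
      (hc Complex.I))
  have key : ∀ x ∈ Set.uIcc a b, (∫ s in a..x, f s) =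
      (((fun x => ∫ s in a..x, (f s).re) • fun _ : ℝ => (1 : ℂ)) +
        ((fun x => ∫ s in a..x, (f s).im) • fun _ : ℝ => Complex.I)) x := by
    intro x hx
    have hsub : Set.uIcc a x ⊆ Set.uIcc a b := Set.uIcc_subset_uIcc_left hx
    simp only [Pi.add_apply, Pi.smul_apply', Complex.real_smul, mul_one]
    rw [← intervalIntegral.integral_ofReal, ← intervalIntegral.integral_ofReal,
      ← intervalIntegral.integral_mul_const, ← intervalIntegral.integral_add]
    · simp [Complex.re_add_im]
    · have := (hre.mono_set hsub)
      exact ⟨this.1.ofReal, this.2.ofReal⟩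
    · have := (him.mono_set hsub)
      exact (show IntervalIntegrable (fun s => ((f s).im : ℂ)) volume a x from
        ⟨this.1.ofReal, this.2.ofReal⟩).mul_const _
  rw [absolutelyContinuousOnInterval_iff] at h1 ⊢
  intro ε hε
  obtain ⟨δ, hδ, H⟩ := h1 ε hε
  refine ⟨δ, hδ, fun E hE hE2 => ?_⟩
  have := H E hE hE2
  refine lt_of_le_of_lt (le_of_eq ?_) this
  refine Finset.sum_congr rfl fun i hi => ?_
  have hm := hE.1 i hi
  rw [key _ hm.1, key _ hm.2]

/-- Integration by parts for a factor `f` that is only absolutely continuous: the product minus the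
candidate integral is absolutely continuous with derivative zero almost everywhere, hence constant.
-/
theorem mul_sub_mul_eq_integral {u u' f f₁ : ℝ → ℂ} {a b : ℝ}
    (hu : ∀ x ∈ Set.uIcc a b, HasDerivAt u (u' x) x) (hu' : ContinuousOn u' (Set.uIcc a b))
    (hf₁ : IntervalIntegrable f₁ volume a b)
    (hf : ∀ x ∈ Set.uIcc a b, f x = f a + ∫ s in a..x, f₁ s) :
    IntervalIntegrable (fun x => u' x * f x + u x * f₁ x) volume a b ∧
    u b * f b - u a * f a = ∫ x in a..b, (u' x * f x + u x * f₁ x) := by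
  set F : ℝ → ℂ := fun x => f a + ∫ s in a..x, f₁ s with hF
  have hc (z : ℂ) : AbsolutelyContinuousOnInterval (fun _ : ℝ => z) a b :=
    LipschitzOnWith.absolutelyContinuousOnInterval (K := 0)
      ((LipschitzWith.const z).lipschitzOnWith)
  have hFac : AbsolutelyContinuousOnInterval F a b :=
    (hc (f a)).add (absolutelyContinuousOnInterval_integral hf₁)
  have huc : ContinuousOn u (Set.uIcc a b) := fun x hx =>
    (hu x hx).continuousAt.continuousWithinAt
  have hint : IntervalIntegrable (fun x => u' x * F x + u x * f₁ x) volume a b :=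
    (hu'.mul hFac.continuousOn).intervalIntegrable.add (hf₁.continuousOn_mul huc)
  have hcongr : Set.EqOn (fun x => u' x * f x + u x * f₁ x)
      (fun x => u' x * F x + u x * f₁ x) (Set.uIcc a b) := fun x hx => by
    simp only [hf x hx, hF]
  have huac : AbsolutelyContinuousOnInterval u a b := by
    obtain ⟨C, hC⟩ := isCompact_uIcc.exists_bound_of_continuousOn hu'
    refine LipschitzOnWith.absolutelyContinuousOnInterval (K := C.toNNReal) ?_
    refine Convex.lipschitzOnWith_of_nnnorm_hasDerivWithin_le (convex_uIcc a b)
      (fun x hx => (hu x hx).hasDerivWithinAt) fun x hx => ?_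
    rw [← NNReal.coe_le_coe, coe_nnnorm]
    exact (hC x hx).trans (Real.le_coe_toNNReal C)
  have hGac := (huac.smul hFac).sub (absolutelyContinuousOnInterval_integral hint)
  obtain ⟨K, hK⟩ := hGac.const_of_ae_hasDerivAt_zero (by
    filter_upwards [hf₁.ae_hasDerivAt_integral, hint.ae_hasDerivAt_integral] with x h1 h2 hx
    have hFd : HasDerivAt F (f₁ x) x := by
      simpa [hF] using (h1 hx a (by simp)).const_add (f a)
    have := ((hu x hx).mul hFd).sub (h2 hx a (by simp))
    rw [sub_self] at this
    exact this)
  have e1 := hK a (by simp)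
  have e2 := hK b (by simp)
  simp only [Pi.sub_apply, smul_eq_mul, intervalIntegral.integral_same,
    sub_zero] at e1 e2
  refine ⟨hint.congr (hcongr.symm.mono Set.uIoc_subset_uIcc), ?_⟩
  rw [intervalIntegral.integral_congr hcongr, hf b (by simp)]
  have e3 : F a = f a := by simp [hF]
  simp only [Pi.mul_apply, e3] at e1 e2
  linear_combination e2 - e1

/-! ### Fubini on the plane -/

/-- The point with coordinates `a`, `b`. -/
def pt (a b : ℝ) : Plane := WithLp.toLp 2 ![a, b]

@[simp] theorem pt_zero (a b : ℝ) : pt a b 0 = a := rfl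
@[simp] theorem pt_one (a b : ℝ) : pt a b 1 = b := rfl

/-- The plane as a product of lines, with the coordinates exchanged. -/
def planeEquiv : ℝ × ℝ ≃ᵐ Plane :=
  MeasurableEquiv.prodComm.trans
    (MeasurableEquiv.finTwoArrow.symm.trans (MeasurableEquiv.toLp 2 (Fin 2 → ℝ)))

theorem planeEquiv_apply (q : ℝ × ℝ) : planeEquiv q = pt q.2 q.1 := by
  ext i; fin_cases i <;> rfl

theorem measurePreserving_planeEquiv :
    MeasurePreserving planeEquiv (volume.prod volume) volume := by
  have h1 : MeasurePreserving (MeasurableEquiv.prodComm : ℝ × ℝ ≃ᵐ ℝ × ℝ)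
      (volume.prod volume) (volume.prod volume) := Measure.measurePreserving_swap
  have h2 := (volume_preserving_finTwoArrow ℝ).symm
  have h3 := (EuclideanSpace.volume_preserving_symm_measurableEquiv_toLp (Fin 2)).symm
  exact (h3.comp h2).comp h1

theorem ae_ae_of_ae {P : Plane → Prop} (h : ∀ᵐ ζ, P ζ) : ∀ᵐ b : ℝ, ∀ᵐ a : ℝ, P (pt a b) := by
  have := measurePreserving_planeEquiv.quasiMeasurePreserving.ae h
  have := Measure.ae_ae_of_ae_prod this
  simpa [planeEquiv_apply] using this

theorem ae_of_ae_ae {P : Plane → Prop} (hP : NullMeasurableSet {ζ | P ζ} volume)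
    (h : ∀ᵐ b : ℝ, ∀ᵐ a : ℝ, P (pt a b)) : ∀ᵐ ζ, P ζ := by
  obtain ⟨s, hs, hsm, hse⟩ := hP.exists_measurable_subset_ae_eq
  have h1 : ∀ᵐ ζ : Plane, P ζ → ζ ∈ s := by
    filter_upwards [hse] with ζ hζ hp
    exact (iff_of_eq hζ).2 hp
  have h2 : ∀ᵐ q : ℝ × ℝ ∂(volume.prod volume), planeEquiv q ∈ s := by
    refine (Measure.ae_prod_mem_iff_ae_ae_mem (planeEquiv.measurable hsm)).2 ?_
    filter_upwards [h, ae_ae_of_ae h1] with b hb hb1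
    filter_upwards [hb, hb1] with a ha ha1
    simpa [planeEquiv_apply] using ha1 ha
  have h3 : ∀ᵐ ζ : Plane, ζ ∈ s := by
    have := measurePreserving_planeEquiv.symm.quasiMeasurePreserving.ae h2
    simpa using this
  filter_upwards [h3] with ζ hζ using hs hζ

theorem measurable_pt : Measurable fun q : ℝ × ℝ => pt q.2 q.1 := by
  have : (fun q : ℝ × ℝ => pt q.2 q.1) = planeEquiv := by
    funext q; rw [planeEquiv_apply]
  rw [this]; exact planeEquiv.measurable

theorem lintegral_plane {f : Plane → ℝ≥0∞} (hf : AEMeasurable f) :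
    ∫⁻ ζ, f ζ = ∫⁻ b : ℝ, ∫⁻ a : ℝ, f (pt a b) := by
  rw [← measurePreserving_planeEquiv.lintegral_comp_emb planeEquiv.measurableEmbedding,
    lintegral_prod]
  · simp [planeEquiv_apply]
  · exact hf.comp_quasiMeasurePreserving measurePreserving_planeEquiv.quasiMeasurePreserving

theorem eLpNorm_two_sq {α : Type*} [MeasurableSpace α] {μ : Measure α} (f : α → ℂ) :
    eLpNorm f 2 μ ^ 2 = ∫⁻ x, ‖f x‖ₑ ^ 2 ∂μ := by
  have := eLpNorm_nnreal_pow_eq_lintegral (f := f) (μ := μ) (p := 2) (by norm_num)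
  simpa using this

theorem ae_memLp_fiber {f : Plane → ℂ} (hf : MemLp f 2 (volume : Measure Plane)) :
    ∀ᵐ b : ℝ, MemLp (fun a => f (pt a b)) 2 (volume : Measure ℝ) := by
  have hm := hf.1.comp_quasiMeasurePreserving measurePreserving_planeEquiv.quasiMeasurePreserving
  have h1 := hm.prodMk_left
  have h2 : ∫⁻ b : ℝ, ∫⁻ a : ℝ, ‖f (pt a b)‖ₑ ^ 2 < ∞ := by
    rw [← lintegral_plane (hf.1.enorm.pow_const 2), ← eLpNorm_two_sq]
    exact ENNReal.pow_lt_top hf.2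
  have h3 : ∀ᵐ b : ℝ, ∫⁻ a : ℝ, ‖f (pt a b)‖ₑ ^ 2 < ∞ := by
    refine ae_lt_top' ?_ h2.ne
    have := (hm.enorm.pow_const 2).lintegral_prod_right'
    simpa [planeEquiv_apply] using this
  filter_upwards [h1, h3] with b hb1 hb3
  refine ⟨by simpa [planeEquiv_apply] using hb1, ?_⟩
  rw [← eLpNorm_two_sq] at hb3
  by_contra hcon
  simp only [not_lt, top_le_iff] at hcon
  simp [hcon] at hb3

theorem intervalIntegrable_of_memLp {f : ℝ → ℂ} (hf : MemLp f 2 (volume : Measure ℝ)) (a b : ℝ) :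
    IntervalIntegrable f volume a b :=
  ((hf.locallyIntegrable (by norm_num)).integrableOn_isCompact isCompact_uIcc).intervalIntegrable

/-! ### Weak partial derivatives in the first frequency variable -/

/-- On almost every horizontal line `F` is a primitive of `F₁`. -/
def HasXiDeriv (F F₁ : Plane → ℂ) : Prop :=
  ∀ᵐ b : ℝ, ∃ c : ℂ, ∀ᵐ a : ℝ, F (pt a b) = c + ∫ s in (0 : ℝ)..a, F₁ (pt s b)

theorem HasXiDeriv.congr {F F₁ G G₁ : Plane → ℂ} (h : HasXiDeriv F F₁)
    (h0 : F =ᵐ[volume] G) (h1 : F₁ =ᵐ[volume] G₁) : HasXiDeriv G G₁ := by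
  filter_upwards [h, ae_ae_of_ae h0, ae_ae_of_ae h1] with b ⟨c, hc⟩ hb0 hb1
  refine ⟨c, ?_⟩
  filter_upwards [hc, hb0] with a ha ha0
  rw [← ha0, ha]
  congr 1
  exact intervalIntegral.integral_congr_ae (hb1.mono fun s hs _ => hs)

theorem HasXiDeriv.sub {F F₁ G G₁ : Plane → ℂ} (hF : HasXiDeriv F F₁) (hG : HasXiDeriv G G₁)
    (hF₁ : MemLp F₁ 2 (volume : Measure Plane)) (hG₁ : MemLp G₁ 2 (volume : Measure Plane)) :
    HasXiDeriv (fun ζ => F ζ - G ζ) (fun ζ => F₁ ζ - G₁ ζ) := by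
  filter_upwards [hF, hG, ae_memLp_fiber hF₁, ae_memLp_fiber hG₁] with b ⟨c, hc⟩ ⟨d, hd⟩ h1 h2
  refine ⟨c - d, ?_⟩
  filter_upwards [hc, hd] with a ha hb
  rw [ha, hb, intervalIntegral.integral_sub (intervalIntegrable_of_memLp h1 _ _)
    (intervalIntegrable_of_memLp h2 _ _)]
  ring

/-- On a horizontal line `m` is a constant, so nothing is asked of it. This is what allows cutting
into horizontal strips later. -/
theorem HasXiDeriv.mul_left {F F₁ : Plane → ℂ} (hF : HasXiDeriv F F₁) (m : ℝ → ℂ) :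
    HasXiDeriv (fun ζ => m (ζ 1) * F ζ) (fun ζ => m (ζ 1) * F₁ ζ) := by
  filter_upwards [hF] with b ⟨c, hc⟩
  refine ⟨m b * c, ?_⟩
  filter_upwards [hc] with a ha
  simp only [pt_one, intervalIntegral.integral_const_mul, ha]
  ring

/-- Along a subsequence with squared norms at most `2⁻ⁿ`, the sum of the squared fiber norms is
integrable in `b`, hence finite almost everywhere, and its terms tend to zero. -/
theorem exists_subseq_tendsto_fiber {G : ℕ → Plane → ℂ} (hGm : ∀ n, MemLp (G n) 2 volume)
    (hG : Tendsto (fun n => eLpNorm (G n) 2 (volume : Measure Plane)) atTop (𝓝 0)) :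
    ∃ ns : ℕ → ℕ, StrictMono ns ∧ ∀ᵐ b : ℝ,
      Tendsto (fun n => eLpNorm (fun a => G (ns n) (pt a b)) 2 (volume : Measure ℝ))
        atTop (𝓝 0) := by
  have h2 : Tendsto (fun n => eLpNorm (G n) 2 (volume : Measure Plane) ^ 2) atTop (𝓝 0) := by
    simpa using ENNReal.Tendsto.pow (n := 2) hG
  obtain ⟨ns, hns, hle⟩ := extraction_forall_of_eventually
    (P := fun n k => eLpNorm (G k) 2 (volume : Measure Plane) ^ 2 ≤ 2⁻¹ ^ n) fun n =>
      h2.eventually_le_const (ENNReal.pow_pos (by norm_num) n)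
  refine ⟨ns, hns, ?_⟩
  set B : ℕ → ℝ → ℝ≥0∞ := fun n b => ∫⁻ a : ℝ, ‖G (ns n) (pt a b)‖ₑ ^ 2 with hB
  have hBm : ∀ n, AEMeasurable (B n) volume := fun n => by
    have hm := (hGm (ns n)).1.comp_quasiMeasurePreserving
      measurePreserving_planeEquiv.quasiMeasurePreserving
    have := (hm.enorm.pow_const 2).lintegral_prod_right'
    simpa [planeEquiv_apply] using this
  have hsum : ∫⁻ b, ∑' n, B n b < ∞ := by
    rw [lintegral_tsum hBm]
    calc ∑' n, ∫⁻ b, B n b ≤ ∑' n : ℕ, (2⁻¹ : ℝ≥0∞) ^ n := by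
          refine ENNReal.tsum_le_tsum fun n => ?_
          rw [hB, ← lintegral_plane ((hGm (ns n)).1.enorm.pow_const 2), ← eLpNorm_two_sq]
          exact hle n
      _ < ∞ := by rw [ENNReal.tsum_geometric]; norm_num
  filter_upwards [ae_lt_top' (AEMeasurable.tsum hBm) hsum.ne] with b hb
  have h3 := ENNReal.tendsto_atTop_zero_of_tsum_ne_top hb.ne
  have h4 : Tendsto (fun n => (B n b) ^ (1 / 2 : ℝ)) atTop (𝓝 0) := by
    have := (ENNReal.continuous_rpow_const (y := (1 / 2 : ℝ))).tendsto 0 |>.comp h3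
    simpa [Function.comp_def] using this
  refine h4.congr fun n => ?_
  rw [show B n b = ∫⁻ a : ℝ, ‖G (ns n) (pt a b)‖ₑ ^ 2 from rfl, ← eLpNorm_two_sq, ← ENNReal.rpow_natCast, ← ENNReal.rpow_mul]
  norm_num

theorem tendsto_intervalIntegral_of_eLpNorm {f : ℕ → ℝ → ℂ} {g : ℝ → ℂ}
    (hf : ∀ n, MemLp (f n) 2 (volume : Measure ℝ)) (hg : MemLp g 2 (volume : Measure ℝ))
    (h : Tendsto (fun n => eLpNorm (fun s => f n s - g s) 2 (volume : Measure ℝ)) atTop (𝓝 0))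
    (a b : ℝ) : Tendsto (fun n => ∫ s in a..b, f n s) atTop (𝓝 (∫ s in a..b, g s)) := by
  have key : ∀ a b : ℝ, Tendsto (fun n => ∫ s in Set.Ioc a b, f n s) atTop
      (𝓝 (∫ s in Set.Ioc a b, g s)) := fun a b => by
    refine tendsto_integral_of_L1' _ (intervalIntegrable_of_memLp hg a b).1.1
      (Eventually.of_forall fun n => (intervalIntegrable_of_memLp (hf n) a b).1) ?_
    have hv : volume (Set.Ioc a b) ^ (1 / 2 : ℝ) ≠ ∞ := by
      rw [Real.volume_Ioc]; exact ENNReal.rpow_ne_top_of_nonneg (by norm_num) ENNReal.ofReal_ne_top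
    have h0 := ENNReal.Tendsto.mul_const h (b := volume (Set.Ioc a b) ^ (1 / 2 : ℝ))
      (Or.inr hv)
    rw [zero_mul] at h0
    refine tendsto_of_tendsto_of_tendsto_of_le_of_le tendsto_const_nhds h0
      (fun _ => zero_le) fun n => ?_
    have := eLpNorm_le_eLpNorm_mul_rpow_measure_univ (μ := volume.restrict (Set.Ioc a b))
      (p := 1) (q := 2) (f := f n - g) (by norm_num) ((hf n).1.sub hg.1).restrict
    refine this.trans ?_
    rw [Measure.restrict_apply_univ]
    norm_num
    gcongr
    exact eLpNorm_mono_measure _ Measure.restrict_le_self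
  simp only [intervalIntegral]
  exact (key a b).sub (key b a)

/-- The weak derivative is a closed operator: on almost every line the primitives converge along a
subsequence, and so does the relation. -/
theorem HasXiDeriv.of_tendsto {F F₁ : ℕ → L2} {G G₁ : L2}
    (h : ∀ n, HasXiDeriv (F n) (F₁ n)) (hF : Tendsto F atTop (𝓝 G))
    (hF₁ : Tendsto F₁ atTop (𝓝 G₁)) : HasXiDeriv G G₁ := by
  obtain ⟨ns, hns, hae⟩ := (tendstoInMeasure_of_tendsto_Lp hF).exists_seq_tendsto_ae
  have hL : Tendsto (fun n => eLpNorm (fun ζ => F₁ (ns n) ζ - G₁ ζ) 2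
      (volume : Measure Plane)) atTop (𝓝 0) := by
    have := (Lp.tendsto_Lp_iff_tendsto_eLpNorm' F₁ G₁).1 hF₁
    exact this.comp hns.tendsto_atTop
  obtain ⟨ms, hms, hfib⟩ := exists_subseq_tendsto_fiber
    (fun n => (Lp.memLp (F₁ (ns n))).sub (Lp.memLp G₁)) hL
  filter_upwards [ae_ae_of_ae hae, hfib, ae_memLp_fiber (Lp.memLp G₁),
    ae_all_iff.2 fun n => ae_memLp_fiber (Lp.memLp (F₁ n)), ae_all_iff.2 h]
    with b hb hb1 hg hf hc
  choose c hc using hc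
  have hlim : ∀ a : ℝ, Tendsto (fun n => ∫ s in (0 : ℝ)..a, F₁ (ns (ms n)) (pt s b)) atTop
      (𝓝 (∫ s in (0 : ℝ)..a, G₁ (pt s b))) := fun a =>
    tendsto_intervalIntegral_of_eLpNorm (fun n => hf _) hg hb1 0 a
  have hall : ∀ᵐ a : ℝ, (∀ n, F n (pt a b) = c n + ∫ s in (0 : ℝ)..a, F₁ n (pt s b)) ∧
      Tendsto (fun n => F (ns n) (pt a b)) atTop (𝓝 (G (pt a b))) :=
    (ae_all_iff.2 hc).and hb
  -- One point of convergence on the line is enough to make the constants of integration converge.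
  obtain ⟨a₀, h0, h0'⟩ := hall.exists
  have hcl : Tendsto (fun n => c (ns (ms n))) atTop
      (𝓝 (G (pt a₀ b) - ∫ s in (0 : ℝ)..a₀, G₁ (pt s b))) := by
    refine ((h0'.comp hms.tendsto_atTop).sub (hlim a₀)).congr fun n => ?_
    simp [h0]
  refine ⟨G (pt a₀ b) - ∫ s in (0 : ℝ)..a₀, G₁ (pt s b), ?_⟩
  filter_upwards [hall] with a ⟨ha, ha'⟩
  refine tendsto_nhds_unique (ha'.comp hms.tendsto_atTop) ?_
  refine (hcl.add (hlim a)).congr fun n => ?_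
  simp [ha]

/-- Multiplication by `xMul` on the physical side corresponds to the derivative in the first
frequency variable. -/
def xMul (p : Plane) : ℂ := -(2 * Real.pi * Complex.I) * (p 0 : ℂ)

theorem continuous_xMul : Continuous xMul := by unfold xMul; fun_prop

theorem norm_xMul (p : Plane) : ‖xMul p‖ = 2 * Real.pi * |p 0| := by
  simp [xMul, abs_of_pos Real.pi_pos]

/-- `xMul` is purely imaginary, so `|1 - xMul|` dominates both 1 and `|xMul|`; these are resolvent
bounds for a skew-adjoint operator. -/
theorem one_sub_xMul_bounds (p : Plane) :
    1 - xMul p ≠ 0 ∧ ‖(1 - xMul p)⁻¹‖ ≤ 1 ∧ ‖xMul p * (1 - xMul p)⁻¹‖ ≤ 1 := by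
  have hre : (1 - xMul p).re = 1 := by simp [xMul]
  have him : (1 - xMul p).im = -(xMul p).im := by simp
  have hx : xMul p = ((xMul p).im : ℂ) * Complex.I := by
    apply Complex.ext <;> simp [xMul]
  have h1 : 1 ≤ ‖1 - xMul p‖ := by
    have := Complex.abs_re_le_norm (1 - xMul p)
    rwa [hre, abs_one] at this
  have h2 : ‖xMul p‖ ≤ ‖1 - xMul p‖ := by
    have := Complex.abs_im_le_norm (1 - xMul p)
    rw [him, abs_neg] at this
    rw [hx, norm_mul, Complex.norm_I, mul_one, Complex.norm_real, Real.norm_eq_abs, ← hx]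
    exact this
  have h0 : 0 < ‖1 - xMul p‖ := by linarith
  refine ⟨norm_pos_iff.1 h0, ?_, ?_⟩
  · rw [norm_inv]; exact inv_le_one_of_one_le₀ h1
  · rw [norm_mul, norm_inv, ← div_eq_mul_inv]
    exact (div_le_one h0).2 h2

/-- For Schwartz functions the line derivative of the transform is classical, and the fundamental
theorem of calculus applies on every horizontal line. -/
theorem hasXiDeriv_fourier_schwartz (f : SchwartzMap Plane ℂ) :
    ∃ g : SchwartzMap Plane ℂ, (∀ p, g p = xMul p * f p) ∧
      HasXiDeriv (𝓕 f : SchwartzMap Plane ℂ) (𝓕 g : SchwartzMap Plane ℂ) := by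
  set e : Plane := EuclideanSpace.single 0 1 with he
  set g := -(2 * Real.pi * Complex.I) • SchwartzMap.smulLeftCLM ℂ (inner ℝ · e) f with hg
  have ht : (inner ℝ · e).HasTemperateGrowth := ((innerSL ℝ).flip e).hasTemperateGrowth
  refine ⟨g, fun p => ?_, ?_⟩
  · rw [hg, _root_.smul_apply, SchwartzMap.smulLeftCLM_apply_apply ht, xMul, he,
      EuclideanSpace.inner_single_right]
    simp
    ring
  · refine Eventually.of_forall fun b => ⟨(𝓕 f : SchwartzMap Plane ℂ) (pt 0 b),
      Eventually.of_forall fun a => ?_⟩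
    have hline : ∀ s : ℝ, pt s b = pt 0 b + s • e := fun s => by
      ext i; fin_cases i <;> simp [pt, he]
    have hd : ∀ s : ℝ, HasDerivAt (fun s => (𝓕 f : SchwartzMap Plane ℂ) (pt s b))
        ((𝓕 g : SchwartzMap Plane ℂ) (pt s b)) s := fun s => by
      have h1 : (𝓕 g : SchwartzMap Plane ℂ) = LineDeriv.lineDerivOp e (𝓕 f) :=
        (SchwartzMap.lineDerivOp_fourier_eq f e).symm
      have h2 : HasDerivAt (fun s : ℝ => pt 0 b + s • e) e s := by
        simpa using ((hasDerivAt_id s).smul_const e).const_add (pt 0 b)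
      have h3 := ((𝓕 f : SchwartzMap Plane ℂ).differentiableAt
        (x := pt 0 b + s • e)).hasFDerivAt.comp_hasDerivAt s h2
      rw [h1, SchwartzMap.lineDerivOp_apply_eq_fderiv]
      rw [show (fun s => (𝓕 f : SchwartzMap Plane ℂ) (pt s b)) =
        (𝓕 f : SchwartzMap Plane ℂ) ∘ fun s : ℝ => pt 0 b + s • e from
        funext fun s => by rw [hline s]; rfl, hline s]
      exact h3
    have hc : Continuous fun s => (𝓕 g : SchwartzMap Plane ℂ) (pt s b) := by
      refine (𝓕 g : SchwartzMap Plane ℂ).continuous.comp ?_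
      rw [show (fun s => pt s b) = fun s : ℝ => pt 0 b + s • e from funext hline]
      fun_prop
    rw [intervalIntegral.integral_eq_sub_of_hasDerivAt (fun s _ => hd s)
      (hc.intervalIntegrable _ _)]
    ring

/-- Approximate `φ - φ₁ = (1 - xMul) φ` by test functions `g n`. By the resolvent bounds, `(1 -
xMul)⁻¹ g n` converges to `φ` and its product with `xMul` to `φ₁`; closedness passes the Schwartz
case to the limit. -/
theorem hasXiDeriv_fourier {φ φ₁ : L2} (h : φ₁ =ᵐ[volume] fun p => xMul p * φ p) :
    HasXiDeriv (𝓕 φ : L2) (𝓕 φ₁ : L2) := by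
  have hd := Lp.dense_hasCompactSupport_contDiff (F := ℂ) (E := Plane)
    (μ := (volume : Measure Plane)) (p := 2) (by norm_num)
  obtain ⟨χ, hχ, hlim⟩ := mem_closure_iff_seq_limit.1 (hd (φ - φ₁))
  choose g hχg hgc hgs using hχ
  have hxs : ContDiff ℝ (⊤ : ℕ∞) fun p : Plane => (1 - xMul p)⁻¹ := by
    refine ContDiff.inv ?_ fun p => (one_sub_xMul_bounds p).1
    unfold xMul
    have : ContDiff ℝ (⊤ : ℕ∞) fun p : Plane => ((p 0 : ℝ) : ℂ) :=
      Complex.ofRealCLM.contDiff.comp (EuclideanSpace.proj (𝕜 := ℝ) (0 : Fin 2)).contDiff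
    fun_prop
  set f : ℕ → SchwartzMap Plane ℂ := fun n =>
    (((hgc n).mul_left (f := fun p => (1 - xMul p)⁻¹)).toSchwartzMap (hxs.mul (hgs n))) with hf
  have hfa : ∀ n p, f n p = (1 - xMul p)⁻¹ * g n p := fun n p => rfl
  choose f₁ hf₁ hfd using fun n => hasXiDeriv_fourier_schwartz (f n)
  have hsub := fun n => Lp.coeFn_sub (χ n) (φ - φ₁)
  have hsub' := Lp.coeFn_sub φ φ₁
  have hl0 : Tendsto (fun n => (f n).toLp 2 (volume : Measure Plane)) atTop (𝓝 φ) := by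
    rw [tendsto_iff_norm_sub_tendsto_zero] at hlim ⊢
    refine squeeze_zero (fun _ => norm_nonneg _) (fun n => ?_) hlim
    refine Lp.norm_le_norm_of_ae_le ?_
    filter_upwards [Lp.coeFn_sub ((f n).toLp 2 (volume : Measure Plane)) φ, hsub n, hsub', hχg n,
      h, (f n).coeFn_toLp 2 (volume : Measure Plane)] with p h1 h2 h3 h4 h5 h6
    obtain ⟨hne, hb, -⟩ := one_sub_xMul_bounds p
    rw [h1, h2]
    simp only [Pi.sub_apply]
    rw [h3, h4, h6, hfa]
    simp only [Pi.sub_apply]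
    rw [h5, show (1 - xMul p)⁻¹ * g n p - φ p
      = (1 - xMul p)⁻¹ * (g n p - (φ p - xMul p * φ p)) by field_simp, norm_mul]
    exact mul_le_of_le_one_left (norm_nonneg _) hb
  have hl1 : Tendsto (fun n => (f₁ n).toLp 2 (volume : Measure Plane)) atTop (𝓝 φ₁) := by
    rw [tendsto_iff_norm_sub_tendsto_zero] at hlim ⊢
    refine squeeze_zero (fun _ => norm_nonneg _) (fun n => ?_) hlim
    refine Lp.norm_le_norm_of_ae_le ?_
    filter_upwards [Lp.coeFn_sub ((f₁ n).toLp 2 (volume : Measure Plane)) φ₁, hsub n, hsub', hχg n,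
      h, (f₁ n).coeFn_toLp 2 (volume : Measure Plane)] with p h1 h2 h3 h4 h5 h6
    obtain ⟨hne, -, hb⟩ := one_sub_xMul_bounds p
    rw [h1, h2]
    simp only [Pi.sub_apply]
    rw [h3, h4, h6, hf₁, hfa]
    simp only [Pi.sub_apply]
    rw [h5, show xMul p * ((1 - xMul p)⁻¹ * g n p) - xMul p * φ p
      = (xMul p * (1 - xMul p)⁻¹) * (g n p - (φ p - xMul p * φ p)) by field_simp, norm_mul]
    exact mul_le_of_le_one_left (norm_nonneg _) hb
  have hcont : Continuous fun ψ : L2 => (𝓕 ψ : L2) :=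
    (Lp.fourierTransformₗᵢ Plane ℂ).continuous
  refine HasXiDeriv.of_tendsto (fun n => ?_) ((hcont.tendsto _).comp hl0)
    ((hcont.tendsto _).comp hl1)
  simp only [Function.comp_apply, SchwartzMap.toLp_fourier_eq]
  exact (hfd n).congr ((𝓕 (f n) : SchwartzMap Plane ℂ).coeFn_toLp 2 volume).symm
    ((𝓕 (f₁ n) : SchwartzMap Plane ℂ).coeFn_toLp 2 volume).symm

/-- The right side solves `y' = y`, hence equals `c * exp a`, which is square integrable on `[0, ∞)`
only for `c = 0`. -/
theorem eq_zero_of_eq_const_add_integral {d : ℝ → ℂ} {c : ℂ}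
    (hd : MemLp d 2 (volume : Measure ℝ)) (h : ∀ᵐ a, d a = c + ∫ s in (0 : ℝ)..a, d s) :
    ∀ᵐ a, d a = 0 := by
  set y : ℝ → ℂ := fun a => c + ∫ s in (0 : ℝ)..a, d s with hy
  have hint := intervalIntegrable_of_memLp hd
  have hyc : Continuous y := continuous_const.add
    (intervalIntegral.continuous_primitive hint 0)
  have hyy : ∀ a, y a = c + ∫ s in (0 : ℝ)..a, y s := fun a => by
    exact congrArg (c + ·) (intervalIntegral.integral_congr_ae (h.mono fun s hs _ => hs))
  have hyd : ∀ a, HasDerivAt y (y a) a := fun a => by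
    have h1 := (intervalIntegral.integral_hasDerivAt_right (hyc.intervalIntegrable 0 a)
      (hyc.stronglyMeasurableAtFilter _ _) hyc.continuousAt).const_add c
    have h2 : (fun a => c + ∫ s in (0 : ℝ)..a, y s) = y := funext fun a => (hyy a).symm
    rwa [h2] at h1
  have hconst : ∀ a, y a = c * Complex.exp a := by
    have hz : ∀ a : ℝ, HasDerivAt (fun a : ℝ => y a * Complex.exp (-a)) 0 a := fun a => by
      have he : HasDerivAt (fun a : ℝ => Complex.exp (-(a : ℂ)))
          (Complex.exp (-(a : ℂ)) * -1) a :=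
        (Complex.ofRealCLM.hasDerivAt (x := a)).neg.cexp
      have := (hyd a).mul he
      convert! this using 1
      ring
    intro a
    have := is_const_of_deriv_eq_zero (fun a => (hz a).differentiableAt)
      (fun a => (hz a).deriv) a 0
    have h0 : y 0 = c := by simp [hy]
    simp only [Complex.ofReal_zero, neg_zero, Complex.exp_zero, mul_one, h0] at this
    rw [← this, mul_assoc, ← Complex.exp_add]
    simp
  have hyL : MemLp y 2 (volume : Measure ℝ) := hd.ae_eq h
  have hc : c = 0 := by
    by_contra hc
    have h1 := ENNReal.pow_lt_top (n := 2) hyL.2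
    rw [eLpNorm_two_sq] at h1
    have h2 : ∫⁻ _ in Set.Ici (0 : ℝ), ‖c‖ₑ ^ 2 ≤ ∫⁻ a, ‖y a‖ₑ ^ 2 := by
      refine le_trans (setLIntegral_mono' measurableSet_Ici fun a ha => ?_)
        (setLIntegral_le_lintegral _ _)
      rw [hconst, ← ofReal_norm, ← ofReal_norm, norm_mul, ← Complex.ofReal_exp,
        Complex.norm_real, Real.norm_eq_abs, Real.abs_exp]
      gcongr
      exact le_mul_of_one_le_right (norm_nonneg _) (Real.one_le_exp ha)
    rw [setLIntegral_const, Real.volume_Ici, ENNReal.mul_top (by simp [hc])] at h2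
    exact absurd (h2.trans_lt h1) (lt_irrefl _)
  filter_upwards [h] with a ha
  have := hconst a
  rw [hc, zero_mul] at this
  rw [ha, hc]
  simpa [hy, hc] using this

/-- The resolvent produces `ψ` with `(1 - xMul) ψ = 𝓕⁻ (F - F₁)`. By the direct statement `D = F - 𝓕
ψ` is its own weak derivative, so it vanishes on almost every line and `F = 𝓕 ψ`. -/
theorem fourierInv_xiDeriv {F F₁ : L2} (h : HasXiDeriv F F₁) :
    (𝓕⁻ F₁ : L2) =ᵐ[volume] fun p => xMul p * (𝓕⁻ F : L2) p := by
  set X : L2 := 𝓕⁻ (F - F₁) with hX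
  have hcm : Continuous fun p => (1 - xMul p)⁻¹ :=
    (continuous_const.sub continuous_xMul).inv₀ fun p => (one_sub_xMul_bounds p).1
  have hm0 : MemLp (fun p => (1 - xMul p)⁻¹ * X p) 2 (volume : Measure Plane) :=
    (Lp.memLp X).of_le (hcm.aestronglyMeasurable.mul (Lp.aestronglyMeasurable X))
      (Eventually.of_forall fun p => by
        rw [norm_mul]
        exact mul_le_of_le_one_left (norm_nonneg _) (one_sub_xMul_bounds p).2.1)
  have hm1 : MemLp (fun p => xMul p * (1 - xMul p)⁻¹ * X p) 2 (volume : Measure Plane) :=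
    (Lp.memLp X).of_le
      ((continuous_xMul.mul hcm).aestronglyMeasurable.mul (Lp.aestronglyMeasurable X))
      (Eventually.of_forall fun p => by
        rw [norm_mul]
        exact mul_le_of_le_one_left (norm_nonneg _) (one_sub_xMul_bounds p).2.2)
  set ψ : L2 := hm0.toLp
  set ψ₁ : L2 := hm1.toLp
  have hψψ₁ : ψ₁ =ᵐ[volume] fun p => xMul p * ψ p := by
    filter_upwards [hm0.coeFn_toLp, hm1.coeFn_toLp] with p h0 h1
    rw [h0, h1, mul_assoc]
  have hψX : ψ - ψ₁ = X := by
    apply Lp.ext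
    filter_upwards [Lp.coeFn_sub ψ ψ₁, hm0.coeFn_toLp, hm1.coeFn_toLp] with p h2 h0 h1
    have := (one_sub_xMul_bounds p).1
    rw [h2, Pi.sub_apply, h0, h1]
    field_simp
  have hfs : ∀ f g : L2, (𝓕 (f - g) : L2) = 𝓕 f - 𝓕 g :=
    fun f g => (Lp.fourierTransformₗᵢ Plane ℂ).map_sub f g
  have hF : F - F₁ = 𝓕 ψ - 𝓕 ψ₁ := by
    rw [← hfs, hψX, hX, FourierTransform.fourier_fourierInv_eq]
  set D : L2 := F - 𝓕 ψ with hDdef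
  have hD1 : D = F₁ - 𝓕 ψ₁ := by
    rw [hDdef, sub_eq_sub_iff_sub_eq_sub]; exact hF
  have hDx : HasXiDeriv D D := by
    have h3 := (h.sub (hasXiDeriv_fourier hψψ₁) (Lp.memLp _) (Lp.memLp _))
    refine h3.congr (Lp.coeFn_sub _ _).symm ?_
    rw [hD1]
    exact (Lp.coeFn_sub _ _).symm
  have hDz : ∀ᵐ ζ, D ζ = 0 := by
    refine ae_of_ae_ae ?_ ?_
    · exact ((Lp.stronglyMeasurable D).measurable (measurableSet_singleton 0)).nullMeasurableSet
    · filter_upwards [hDx, ae_memLp_fiber (Lp.memLp D)] with b ⟨c, hc⟩ hb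
      exact eq_zero_of_eq_const_add_integral hb hc
  have hD0 : D = 0 := (Lp.eq_zero_iff_ae_eq_zero).2 hDz
  have e0 : F = 𝓕 ψ := sub_eq_zero.1 hD0
  have e1 : F₁ = 𝓕 ψ₁ := sub_eq_zero.1 (hD1.symm.trans hD0)
  rw [e0, e1, FourierTransform.fourierInv_fourier_eq, FourierTransform.fourierInv_fourier_eq]
  exact hψψ₁

/-! ### Chains of weak derivatives -/

/-- `F (k + 1)` is the weak derivative of `F k` for `k < r`. -/
def IsXiChain (r : ℕ) (F : ℕ → L2) : Prop := ∀ k < r, HasXiDeriv (F k) (F (k + 1))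

theorem IsXiChain.fourierInv {r : ℕ} {F : ℕ → L2} (h : IsXiChain r F) :
    ∀ k ≤ r, (𝓕⁻ (F k) : L2) =ᵐ[volume] fun p => xMul p ^ k * (𝓕⁻ (F 0) : L2) p := by
  intro k
  induction k with
  | zero => intro _; simp
  | succ k ih =>
    intro hk
    filter_upwards [ih (by omega), fourierInv_xiDeriv (h k (by omega))] with p h1 h2
    rw [h2, h1, pow_succ]
    ring

theorem lintegral_enorm_sq (f : L2) : ∫⁻ p, ‖f p‖ₑ ^ 2 = ‖f‖ₑ ^ 2 := by
  rw [Lp.enorm_def, eLpNorm_two_sq]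

theorem enorm_fourierInv (f : L2) : ‖(𝓕⁻ f : L2)‖ₑ = ‖f‖ₑ := by
  rw [← ofReal_norm, ← ofReal_norm]
  exact congrArg _ ((Lp.fourierTransformₗᵢ Plane ℂ).symm.norm_map f)

theorem enorm_fourier (f : L2) : ‖(𝓕 f : L2)‖ₑ = ‖f‖ₑ := by
  rw [← ofReal_norm, ← ofReal_norm, Lp.norm_fourier_eq]

theorem IsXiChain.lintegral_xMul {r : ℕ} {F : ℕ → L2} (h : IsXiChain r F) {k : ℕ} (hk : k ≤ r) :
    ∫⁻ p, ‖xMul p ^ k * (𝓕⁻ (F 0) : L2) p‖ₑ ^ 2 = ∫⁻ ζ, ‖F k ζ‖ₑ ^ 2 := by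
  rw [lintegral_enorm_sq, ← enorm_fourierInv, ← lintegral_enorm_sq]
  refine lintegral_congr_ae ?_
  filter_upwards [h.fourierInv k hk] with p hp
  rw [hp]

theorem IsXiChain.memLp_xMul {r : ℕ} {F : ℕ → L2} (h : IsXiChain r F) {k : ℕ} (hk : k ≤ r) :
    MemLp (fun p => xMul p ^ k * (𝓕⁻ (F 0) : L2) p) 2 (volume : Measure Plane) :=
  (Lp.memLp (𝓕⁻ (F k) : L2)).ae_eq (h.fourierInv k hk)

/-! ### Interpolation between powers of `1 + η²` and derivatives in `ξ` -/

/-- The weight `1 + η²`. -/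
def lam (ζ : Plane) : ℝ := 1 + eta ζ ^ 2

theorem one_le_lam (ζ : Plane) : 1 ≤ lam ζ := by unfold lam; nlinarith [sq_nonneg (eta ζ)]

theorem lam_pos (ζ : Plane) : 0 < lam ζ := one_pos.trans_le (one_le_lam ζ)

theorem continuous_eta : Continuous eta := by unfold eta; fun_prop

theorem continuous_xi : Continuous xi := by unfold xi; fun_prop

theorem continuous_lam : Continuous lam := by
  unfold lam; exact continuous_const.add (continuous_eta.pow 2)

theorem IsXiChain.mul_left {r : ℕ} {F : ℕ → L2} (h : IsXiChain r F) {m : ℝ → ℂ}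
    (hm : ∀ f : L2, MemLp (fun ζ : Plane => m (ζ 1) * f ζ) 2 volume) :
    IsXiChain r fun k => (hm (F k)).toLp := fun k hk =>
  ((h k hk).mul_left m).congr (hm (F k)).coeFn_toLp.symm (hm (F (k + 1))).coeFn_toLp.symm

theorem pow_mul_pow_sq_le {N X : ℝ} (hN : 1 ≤ N) (hX : 0 ≤ X) {i j r : ℕ} (hij : i + j ≤ r) :
    (N ^ i * X ^ j) ^ 2 ≤ (N ^ r) ^ 2 + (X ^ r) ^ 2 := by
  rcases le_total X N with h | h
  · have : N ^ i * X ^ j ≤ N ^ r := calc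
      N ^ i * X ^ j ≤ N ^ i * N ^ j := by gcongr
      _ = N ^ (i + j) := (pow_add _ _ _).symm
      _ ≤ N ^ r := pow_le_pow_right₀ hN hij
    have h2 : (N ^ i * X ^ j) ^ 2 ≤ (N ^ r) ^ 2 := by gcongr
    nlinarith [sq_nonneg (X ^ r)]
  · have : N ^ i * X ^ j ≤ X ^ r := calc
      N ^ i * X ^ j ≤ X ^ i * X ^ j := by gcongr
      _ = X ^ (i + j) := (pow_add _ _ _).symm
      _ ≤ X ^ r := pow_le_pow_right₀ (hN.trans h) hij
    have h2 : (N ^ i * X ^ j) ^ 2 ≤ (X ^ r) ^ 2 := by gcongr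
    nlinarith [sq_nonneg (N ^ r)]

/-- A constant weight commutes with the Fourier transform. By Plancherel the claim moves to the
physical side, where derivatives are powers of `xMul` and the inequality is pointwise. -/
theorem IsXiChain.lintegral_const_pow {r : ℕ} {F : ℕ → L2} (h : IsXiChain r F) {i j : ℕ}
    (hij : i + j ≤ r) {N : ℝ} (hN : 1 ≤ N) :
    ∫⁻ ζ, ‖((N ^ i : ℝ) : ℂ) * F j ζ‖ₑ ^ 2 ≤
      (∫⁻ ζ, ‖((N ^ r : ℝ) : ℂ) * F 0 ζ‖ₑ ^ 2) + ∫⁻ ζ, ‖F r ζ‖ₑ ^ 2 := by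
  have hc : ∀ (k l : ℕ), l ≤ r → ∫⁻ ζ, ‖((N ^ k : ℝ) : ℂ) * F l ζ‖ₑ ^ 2 =
      ∫⁻ p, ‖((N ^ k : ℝ) : ℂ) * (xMul p ^ l * (𝓕⁻ (F 0) : L2) p)‖ₑ ^ 2 := fun k l hl => by
    simp only [enorm_mul, mul_pow _ (‖xMul _ ^ l‖ₑ * _), mul_pow _ ‖F l _‖ₑ]
    rw [lintegral_const_mul' _ _ (by simp), lintegral_const_mul' _ _ (by simp),
      ← h.lintegral_xMul hl]
    simp only [enorm_mul]
  rw [hc i j (by omega), hc r 0 (by omega), ← h.lintegral_xMul le_rfl, ← lintegral_add_right']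
  · refine lintegral_mono fun p => ?_
    simp only [pow_zero, one_mul]
    rw [← ofReal_norm, ← ofReal_norm, ← ofReal_norm, ← ENNReal.ofReal_pow (norm_nonneg _),
      ← ENNReal.ofReal_pow (norm_nonneg _), ← ENNReal.ofReal_pow (norm_nonneg _),
      ← ENNReal.ofReal_add (by positivity) (by positivity)]
    refine ENNReal.ofReal_le_ofReal ?_
    have := pow_mul_pow_sq_le hN (norm_nonneg (xMul p)) hij
    have h0 : (0 : ℝ) ≤ N := by linarith
    simp only [norm_mul, norm_pow, Complex.norm_real, Real.norm_of_nonneg h0]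
    calc (N ^ i * (‖xMul p‖ ^ j * ‖(𝓕⁻ (F 0) : L2) p‖)) ^ 2
        = (N ^ i * ‖xMul p‖ ^ j) ^ 2 * ‖(𝓕⁻ (F 0) : L2) p‖ ^ 2 := by ring
      _ ≤ ((N ^ r) ^ 2 + (‖xMul p‖ ^ r) ^ 2) * ‖(𝓕⁻ (F 0) : L2) p‖ ^ 2 := by gcongr
      _ = _ := by ring
  · exact (h.memLp_xMul le_rfl).1.enorm.pow_const 2

/-- Interpolation between the weights `x ^ r` and `(1 + η²) ^ r`. -/
theorem IsXiChain.lintegral_lam_pow {r : ℕ} {F : ℕ → L2} (h : IsXiChain r F) {i j : ℕ}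
    (hij : i + j ≤ r) :
    ∫⁻ ζ, ‖((lam ζ ^ i : ℝ) : ℂ) * F j ζ‖ₑ ^ 2 ≤
      (∫⁻ ζ, ‖(((2 * lam ζ) ^ r : ℝ) : ℂ) * F 0 ζ‖ₑ ^ 2) + ∫⁻ ζ, ‖F r ζ‖ₑ ^ 2 := by
  -- On each strip the weight is comparable to the constant `N`. The strips depend on `η` only, so
  -- cutting to one of them preserves the chain.
  set S : ℕ → Set Plane := fun N => {ζ | ⌈lam ζ⌉₊ = N} with hS
  have hSm : ∀ N, MeasurableSet (S N) := fun N =>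
    (Nat.measurable_ceil.comp continuous_lam.measurable) (measurableSet_singleton N)
  have hSd : Pairwise (Function.onFun Disjoint S) := fun N M hNM =>
    Set.disjoint_left.2 fun ζ h1 h2 => hNM (h1.symm.trans h2)
  have hSu : ⋃ N, S N = Set.univ := Set.eq_univ_of_forall fun ζ => Set.mem_iUnion.2 ⟨_, rfl⟩
  have hsplit : ∀ f : Plane → ℝ≥0∞, ∫⁻ ζ, f ζ = ∑' N, ∫⁻ ζ in S N, f ζ := fun f => by
    rw [← lintegral_iUnion hSm hSd, hSu, setLIntegral_univ]
  rw [← lintegral_add_right' _ ((Lp.aestronglyMeasurable (F r)).enorm.pow_const 2), hsplit,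
    hsplit]
  refine ENNReal.tsum_le_tsum fun N => ?_
  by_cases hN0 : N = 0
  · have : S N = ∅ := Set.eq_empty_of_forall_notMem fun ζ hζ => by
      have h1 := one_le_lam ζ
      have h2 := Nat.ceil_eq_zero.1 (show ⌈lam ζ⌉₊ = 0 by rw [show ⌈lam ζ⌉₊ = N from hζ, hN0])
      linarith
    simp [this]
  have hN : (1 : ℝ) ≤ N := by exact_mod_cast Nat.one_le_iff_ne_zero.2 hN0
  set m : ℝ → ℂ := fun b => if ⌈lam (pt 0 b)⌉₊ = N then 1 else 0 with hm
  have hmS : ∀ (f : L2) ζ, m (ζ 1) * f ζ = (S N).indicator f ζ := fun f ζ => by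
    have : lam (pt 0 (ζ 1)) = lam ζ := rfl
    by_cases hζ : ⌈lam ζ⌉₊ = N
    · rw [Set.indicator_of_mem (show ζ ∈ S N from hζ), hm]
      simp [this, hζ]
    · rw [Set.indicator_of_notMem (show ζ ∉ S N from hζ), hm]
      simp [this, hζ]
  have hmL : ∀ f : L2, MemLp (fun ζ : Plane => m (ζ 1) * f ζ) 2 volume := fun f => by
    simp only [hmS]
    exact (Lp.memLp f).indicator (hSm N)
  have key := (h.mul_left hmL).lintegral_const_pow hij hN
  have hconv : ∀ (g : ℝ) (f : L2), ∫⁻ ζ, ‖(g : ℂ) * (hmL f).toLp _ ζ‖ₑ ^ 2 =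
      ∫⁻ ζ in S N, ‖(g : ℂ) * f ζ‖ₑ ^ 2 := fun g f => by
    rw [← lintegral_indicator (hSm N)]
    refine lintegral_congr_ae ?_
    filter_upwards [(hmL f).coeFn_toLp] with ζ hζ
    rw [hζ, hmS]
    by_cases hζ : ζ ∈ S N <;> simp [hζ]
  have hconv1 := fun f => hconv 1 f
  simp only [Complex.ofReal_one, one_mul] at hconv1
  rw [hconv, hconv, hconv1] at key
  rw [lintegral_add_right' _ ((Lp.aestronglyMeasurable (F r)).enorm.pow_const 2).restrict]
  refine le_trans (le_trans ?_ key) ?_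
  · refine setLIntegral_mono' (hSm N) fun ζ hζ => ?_
    have h1 : lam ζ ≤ N := by rw [← show ⌈lam ζ⌉₊ = N from hζ]; exact Nat.le_ceil _
    have h0 := (lam_pos ζ).le
    rw [← ofReal_norm, ← ofReal_norm, norm_mul, norm_mul, Complex.norm_real, Complex.norm_real,
      Real.norm_of_nonneg (by positivity), Real.norm_of_nonneg (by positivity)]
    gcongr
  · gcongr ?_ + _
    refine setLIntegral_mono' (hSm N) fun ζ hζ => ?_
    -- Rounding up costs at most 1, and `lam ≥ 1`; this is the origin of the factor 2 in the bound.
    have h1 : (N : ℝ) ≤ 2 * lam ζ := by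
      rw [← show ⌈lam ζ⌉₊ = N from hζ]
      linarith [Nat.ceil_lt_add_one (lam_pos ζ).le, one_le_lam ζ]
    have h0 := (lam_pos ζ).le
    rw [← ofReal_norm, ← ofReal_norm, norm_mul, norm_mul, Complex.norm_real, Complex.norm_real,
      Real.norm_of_nonneg (by positivity), Real.norm_of_nonneg (by positivity)]
    gcongr

/-! ### The weighted space on the Fourier side -/

theorem weight_eq (r : ℕ) (p : Plane) :
    (|p 0| ^ (r : ℝ) + |p 1| ^ (0 : ℝ) : ℝ) = |p 0| ^ r + 1 := by
  rw [Real.rpow_natCast, Real.rpow_zero]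

theorem memLp_xMul_pow {r : ℕ} {φ : L2} (h : MemWeighted r 0 φ) {k : ℕ} (hk : k ≤ r) :
    MemLp (fun p => xMul p ^ k * φ p) 2 (volume : Measure Plane) := by
  have h' := h.const_mul (((2 * Real.pi) ^ k : ℝ) : ℂ)
  refine h'.of_le ((continuous_xMul.pow k).aestronglyMeasurable.mul
    (Lp.aestronglyMeasurable φ)) (Eventually.of_forall fun p => ?_)
  have h1 : |p 0| ^ k ≤ |p 0| ^ r + 1 := by
    rcases le_total |p 0| 1 with hp | hp
    · have := pow_le_one₀ (n := k) (abs_nonneg (p 0)) hp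
      have h2 := pow_nonneg (abs_nonneg (p 0)) r
      linarith
    · linarith [pow_le_pow_right₀ hp hk]
  rw [weight_eq, norm_mul, norm_mul, norm_mul, norm_pow, norm_xMul, Complex.norm_real,
    Complex.norm_real, Real.norm_of_nonneg (by positivity), Real.norm_of_nonneg (by positivity),
    mul_pow, mul_assoc]
  gcongr

open Classical in
/-- The class of `f` in `L²`, or `0` if `f` is not square integrable. -/
def toL2 (f : Plane → ℂ) : L2 :=
  if h : MemLp f 2 (volume : Measure Plane) then h.toLp else 0

theorem toL2_ae {f : Plane → ℂ} (h : MemLp f 2 (volume : Measure Plane)) :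
    toL2 f =ᵐ[volume] f := by
  rw [toL2, dif_pos h]
  exact h.coeFn_toLp

/-- The function `xMul ^ k * φ` as an element of `L²`, when it is one. -/
def xPow (φ : L2) (k : ℕ) : L2 := toL2 fun p => xMul p ^ k * φ p

/-- The weak derivatives of `𝓕 φ` in the first frequency variable. -/
def fourierChain (φ : L2) (k : ℕ) : L2 := 𝓕 (xPow φ k)

theorem xPow_ae {r : ℕ} {φ : L2} (h : MemWeighted r 0 φ) {k : ℕ} (hk : k ≤ r) :
    xPow φ k =ᵐ[volume] fun p => xMul p ^ k * φ p :=
  toL2_ae (memLp_xMul_pow h hk)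

theorem fourierChain_zero (φ : L2) : fourierChain φ 0 = 𝓕 φ := by
  have h : MemLp (fun p => xMul p ^ 0 * φ p) 2 (volume : Measure Plane) := by
    simpa using Lp.memLp φ
  refine congrArg (fun f : L2 => (𝓕 f : L2)) (Lp.ext ?_)
  filter_upwards [toL2_ae h] with p hp
  rw [xPow, hp]; simp

theorem isXiChain_fourierChain {r : ℕ} {φ : L2} (h : MemWeighted r 0 φ) :
    IsXiChain r (fourierChain φ) := fun k hk => by
  refine hasXiDeriv_fourier ?_
  filter_upwards [xPow_ae h hk.le, xPow_ae h hk] with p h1 h2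
  rw [h2, h1, pow_succ]
  ring

/-! ### Derivatives of the propagator on one side of `ξ = 0` -/

open Polynomial in
/-- With `w = (1 + β a)⁻¹`, the `k`-th derivative of `exp (α a w)` in `a` is
`(dPoly α β k)(w) * exp (α a w)`. -/
def dPoly (α β : ℂ) : ℕ → Polynomial ℂ
  | 0 => 1
  -- The recursion comes from `(a w)' = w²` and `w' = -β w²`.
  | k + 1 => X ^ 2 * (C α * dPoly α β k - C β * derivative (dPoly α β k))

open Polynomial in
theorem natDegree_dPoly_le (α β : ℂ) (k : ℕ) : (dPoly α β k).natDegree ≤ 2 * k := by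
  induction k with
  | zero => simp [dPoly]
  | succ k ih =>
    rw [dPoly]
    refine natDegree_mul_le.trans ?_
    have h1 : (C α * dPoly α β k).natDegree ≤ 2 * k := (natDegree_C_mul_le _ _).trans ih
    have h2 : (C β * derivative (dPoly α β k)).natDegree ≤ 2 * k :=
      (natDegree_C_mul_le _ _).trans ((natDegree_derivative_le _).trans (by omega))
    have h3 := (natDegree_sub_le (C α * dPoly α β k) (C β * derivative (dPoly α β k))).trans
      (max_le h1 h2)
    rw [natDegree_X_pow]
    omega

open Polynomial in
-- Each differentiation brings one factor `α`, or a factor `β` that stays bounded; hence the power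
-- of `1 + ‖α‖` is at most the order.
theorem exists_norm_coeff_dPoly_le (B : ℝ) (k : ℕ) : ∃ C : ℝ, 0 ≤ C ∧ ∀ α β : ℂ, ‖β‖ ≤ B →
    ∀ n, ‖(dPoly α β k).coeff n‖ ≤ C * (1 + ‖α‖) ^ k := by
  induction k with
  | zero =>
    refine ⟨1, zero_le_one, fun α β _ n => ?_⟩
    simp only [dPoly, coeff_one, pow_zero, mul_one]
    split_ifs <;> simp
  | succ k ih =>
    obtain ⟨C, hC, h⟩ := ih
    -- The factor `2 * k + 1` bounds the indices brought down by `derivative`, the degree being at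
    -- most `2 * k`.
    refine ⟨C + |B| * (C * (2 * k + 1)), by positivity, fun α β hβ n => ?_⟩
    have hα : (0 : ℝ) ≤ ‖α‖ := norm_nonneg _
    rw [dPoly, coeff_X_pow_mul']
    split_ifs with hn
    · rw [coeff_sub, coeff_C_mul, coeff_C_mul, coeff_derivative]
      set m := n - 2
      have h1 := h α β hβ m
      have h2 : ‖(dPoly α β k).coeff (m + 1) * ((m : ℂ) + 1)‖ ≤
          C * (1 + ‖α‖) ^ k * (2 * k + 1) := by
        by_cases hm : m + 1 ≤ 2 * k
        · rw [norm_mul]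
          have h3 : ‖((m : ℂ) + 1)‖ ≤ 2 * k + 1 := by
            have : ((m : ℂ) + 1) = ((m + 1 : ℕ) : ℂ) := by push_cast; ring
            rw [this, Complex.norm_natCast]
            have : ((m + 1 : ℕ) : ℝ) ≤ ((2 * k : ℕ) : ℝ) := by exact_mod_cast hm
            push_cast at this ⊢
            linarith
          exact mul_le_mul (h α β hβ _) h3 (norm_nonneg _) (by positivity)
        · rw [coeff_eq_zero_of_natDegree_lt
            ((natDegree_dPoly_le α β k).trans_lt (by omega)), zero_mul, norm_zero]
          positivity
      calc _ ≤ ‖α‖ * (C * (1 + ‖α‖) ^ k) + |B| * (C * (1 + ‖α‖) ^ k * (2 * k + 1)) := by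
            refine (norm_sub_le _ _).trans ?_
            rw [norm_mul, norm_mul]
            exact add_le_add (by gcongr) (mul_le_mul (hβ.trans (le_abs_self _)) h2
              (norm_nonneg _) (abs_nonneg _))
        _ ≤ (1 + ‖α‖) * (C * (1 + ‖α‖) ^ k) +
            |B| * (C * (1 + ‖α‖) ^ (k + 1) * (2 * k + 1)) := by
            have : (1 + ‖α‖) ^ k ≤ (1 + ‖α‖) ^ (k + 1) :=
              pow_le_pow_right₀ (by linarith) (by omega)
            gcongr
            linarith
        _ = _ := by ring
    · rw [norm_zero]; positivity

theorem exists_norm_dPoly_le (B : ℝ) (k : ℕ) : ∃ C : ℝ, 0 ≤ C ∧ ∀ α β : ℂ, ‖β‖ ≤ B →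
    ∀ w : ℝ, 0 ≤ w → w ≤ 1 → ‖(dPoly α β k).eval (w : ℂ)‖ ≤ C * (1 + ‖α‖) ^ k := by
  obtain ⟨C, hC, h⟩ := exists_norm_coeff_dPoly_le B k
  refine ⟨(2 * k + 1) * C, by positivity, fun α β hβ w hw hw1 => ?_⟩
  rw [Polynomial.eval_eq_sum_range' (n := 2 * k + 1)
    (Nat.lt_succ_of_le (natDegree_dPoly_le α β k))]
  refine (norm_sum_le _ _).trans ?_
  calc _ ≤ ∑ _i ∈ Finset.range (2 * k + 1), C * (1 + ‖α‖) ^ k := by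
        refine Finset.sum_le_sum fun i _ => ?_
        rw [norm_mul, norm_pow, Complex.norm_real, Real.norm_of_nonneg hw]
        exact (mul_le_of_le_one_right (norm_nonneg _) (pow_le_one₀ hw hw1)).trans (h α β hβ i)
    _ = _ := by rw [Finset.sum_const, Finset.card_range, nsmul_eq_mul]; push_cast; ring

/-- The variable `w = (1 + 2πσ a)⁻¹`. -/
def wSide (σ a : ℝ) : ℝ := (1 + 2 * Real.pi * σ * a)⁻¹

/-- The `k`-th derivative of `exp (α a w)`, where `w = wSide σ a`. -/
def dExp (α : ℂ) (σ : ℝ) (k : ℕ) (a : ℝ) : ℂ :=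
  (dPoly α (2 * Real.pi * σ : ℝ) k).eval (wSide σ a : ℂ) *
    Complex.exp (α * (a * wSide σ a : ℝ))

/-- For fixed `σ` the formula is smooth across the origin, so the derivative at 0 is two-sided. The
singularity of the symbol comes solely from switching `σ` there. -/
theorem hasDerivAt_dExp (α : ℂ) {σ a : ℝ} (k : ℕ) (h : 1 + 2 * Real.pi * σ * a ≠ 0) :
    HasDerivAt (dExp α σ k) (dExp α σ (k + 1) a) a := by
  have hl : HasDerivAt (fun a : ℝ => 1 + 2 * Real.pi * σ * a) (2 * Real.pi * σ) a := by
    simpa using ((hasDerivAt_id a).const_mul (2 * Real.pi * σ)).const_add 1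
  have hw : HasDerivAt (wSide σ) (-(2 * Real.pi * σ) * wSide σ a ^ 2) a := by
    have := hl.inv h
    convert! this using 1
    rw [wSide]; field_simp
  have haw : HasDerivAt (fun a => a * wSide σ a) (wSide σ a ^ 2) a := by
    have := (hasDerivAt_id a).mul hw
    convert! this using 1
    simp only [wSide, id]; field_simp; ring
  have h1 := ((dPoly α (2 * Real.pi * σ : ℝ) k).hasDerivAt (wSide σ a : ℂ)).comp a hw.ofReal_comp
  have h2 := (haw.ofReal_comp.const_mul α).cexp
  have h3 := h1.mul h2
  convert! h3 using 1
  simp only [dExp, dPoly, Polynomial.eval_mul, Polynomial.eval_pow, Polynomial.eval_X,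
    Polynomial.eval_sub, Polynomial.eval_C, Function.comp]
  push_cast
  ring

theorem dExp_zero_right (α : ℂ) (σ : ℝ) (k : ℕ) :
    dExp α σ k 0 = (dPoly α (2 * Real.pi * σ : ℝ) k).eval 1 := by
  simp [dExp, wSide]

theorem dExp_zero (α : ℂ) (σ a : ℝ) : dExp α σ 0 a = Complex.exp (α * (a * wSide σ a : ℝ)) := by
  simp [dExp, dPoly]

/-- The polynomials of order 0 and 1 are `1` and `α X²`, in which `β` does not occur. -/
theorem dExp_one_sub (α : ℂ) {k : ℕ} (hk : k < 2) : dExp α 1 k 0 = dExp α (-1) k 0 := by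
  rw [dExp_zero_right, dExp_zero_right]
  interval_cases k <;> simp [dPoly]

/-- The polynomial of order 2 is `α² X⁴ - 2αβ X³`, and `β = ±2π` on the two sides. This jump is the
source of the vanishing condition. -/
theorem dExp_two_sub (α : ℂ) :
    dExp α 1 2 0 - dExp α (-1) 2 0 = -(8 * Real.pi * α) := by
  rw [dExp_zero_right, dExp_zero_right]
  simp [dPoly]
  ring

/-! ### Chains of primitives on a line -/

/-- For `k < r`, `f k` is a primitive of `f (k + 1)`. -/
structure IsPrimChain (r : ℕ) (f : ℕ → ℝ → ℂ) : Prop where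
  int : ∀ k ≤ r, ∀ a b, IntervalIntegrable (f k) volume a b
  prim : ∀ k < r, ∀ x, f k x = f k 0 + ∫ s in (0 : ℝ)..x, f (k + 1) s

theorem IsPrimChain.continuous {r : ℕ} {f : ℕ → ℝ → ℂ} (h : IsPrimChain r f) {k : ℕ}
    (hk : k < r) : Continuous (f k) := by
  rw [show f k = fun x => f k 0 + ∫ s in (0 : ℝ)..x, f (k + 1) s from funext (h.prim k hk)]
  exact continuous_const.add (intervalIntegral.continuous_primitive (h.int _ hk) 0)

/-- The Leibniz formula for the `k`-th derivative of `exp (α a w) * f 0`. -/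
def leibniz (α : ℂ) (σ : ℝ) (f : ℕ → ℝ → ℂ) (k : ℕ) (a : ℝ) : ℂ :=
  ∑ ij ∈ antidiagonal k, (k.choose ij.1 : ℂ) * (dExp α σ ij.1 a * f ij.2 a)

/-- Pascal's rule regroups the next order as a sum of product-rule pairs, the shape to which
integration by parts applies term by term. -/
theorem leibniz_succ (α : ℂ) (σ : ℝ) (f : ℕ → ℝ → ℂ) (k : ℕ) (a : ℝ) :
    leibniz α σ f (k + 1) a = ∑ ij ∈ antidiagonal k, (k.choose ij.1 : ℂ) *
      (dExp α σ (ij.1 + 1) a * f ij.2 a + dExp α σ ij.1 a * f (ij.2 + 1) a) := by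
  rw [leibniz, Finset.sum_antidiagonal_choose_succ_mul fun i j => dExp α σ i a * f j a,
    ← Finset.sum_add_distrib]
  refine Finset.sum_congr rfl fun ij hij => ?_
  rw [Nat.choose_symm_of_eq_add (mem_antidiagonal.1 hij).symm]
  ring

theorem side_ne_zero {σ a : ℝ} (h : 0 ≤ σ * a) : 1 + 2 * Real.pi * σ * a ≠ 0 := by
  have := mul_nonneg (mul_nonneg zero_le_two Real.pi_pos.le) h
  intro h0
  nlinarith

theorem mul_nonneg_of_mem_uIcc {σ a x : ℝ} (h : 0 ≤ σ * a) (hx : x ∈ Set.uIcc 0 a) :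
    0 ≤ σ * x := by
  rcases Set.mem_uIcc.1 hx with ⟨h1, h2⟩ | ⟨h1, h2⟩
  · rcases le_total 0 σ with hσ | hσ
    · exact mul_nonneg hσ h1
    · nlinarith
  · rcases le_total 0 σ with hσ | hσ
    · nlinarith
    · exact mul_nonneg_of_nonpos_of_nonpos hσ h2

theorem IsPrimChain.leibniz_prim {r : ℕ} {f : ℕ → ℝ → ℂ} (h : IsPrimChain r f) (α : ℂ) {σ a : ℝ}
    (hσ : 0 ≤ σ * a) {k : ℕ} (hk : k < r) :
    IntervalIntegrable (leibniz α σ f (k + 1)) volume 0 a ∧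
      leibniz α σ f k a = leibniz α σ f k 0 + ∫ s in (0 : ℝ)..a, leibniz α σ f (k + 1) s := by
  have hd : ∀ i, ∀ x ∈ Set.uIcc 0 a, HasDerivAt (dExp α σ i) (dExp α σ (i + 1) x) x :=
    fun i x hx => hasDerivAt_dExp α i (side_ne_zero (mul_nonneg_of_mem_uIcc hσ hx))
  have hterm : ∀ ij ∈ antidiagonal k, _ := fun ij hij =>
    mul_sub_mul_eq_integral (u := dExp α σ ij.1) (u' := dExp α σ (ij.1 + 1)) (f := f ij.2)
      (f₁ := f (ij.2 + 1)) (a := 0) (b := a) (hd ij.1)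
      (fun x hx => (hd (ij.1 + 1) x hx).continuousAt.continuousWithinAt)
      (h.int _ (by have := mem_antidiagonal.1 hij; omega) _ _)
      (fun x _ => h.prim _ (by have := mem_antidiagonal.1 hij; omega) x)
  have e : leibniz α σ f (k + 1) = fun s => ∑ ij ∈ antidiagonal k, (k.choose ij.1 : ℂ) *
      (dExp α σ (ij.1 + 1) s * f ij.2 s + dExp α σ ij.1 s * f (ij.2 + 1) s) :=
    funext (leibniz_succ α σ f k)
  have hint : ∀ ij ∈ antidiagonal k, IntervalIntegrable (fun s => (k.choose ij.1 : ℂ) *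
      (dExp α σ (ij.1 + 1) s * f ij.2 s + dExp α σ ij.1 s * f (ij.2 + 1) s)) volume 0 a :=
    fun ij hij => (hterm ij hij).1.const_mul _
  refine ⟨?_, ?_⟩
  · rw [e]
    have := IntervalIntegrable.sum _ hint
    simpa [Finset.sum_fn] using this
  · rw [e, intervalIntegral.integral_finsetSum hint, leibniz, leibniz, ← Finset.sum_add_distrib]
    refine Finset.sum_congr rfl fun ij hij => ?_
    rw [intervalIntegral.integral_const_mul, ← (hterm ij hij).2]
    ring

theorem IsPrimChain.continuousAt_leibniz {r : ℕ} {f : ℕ → ℝ → ℂ} (h : IsPrimChain r f) (α : ℂ)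
    {σ a : ℝ} (hσ : 0 ≤ σ * a) {k : ℕ} (hk : k < r) : ContinuousAt (leibniz α σ f k) a := by
  refine tendsto_finsetSum _ fun ij hij => ?_
  have := mem_antidiagonal.1 hij
  exact tendsto_const_nhds.mul ((hasDerivAt_dExp α _ (side_ne_zero hσ)).continuousAt.mul
    (h.continuous (by omega)).continuousAt)

/-- The side of the origin on which `a` lies. -/
def side (a : ℝ) : ℝ := if 0 ≤ a then 1 else -1

theorem side_mul_nonneg (a : ℝ) : 0 ≤ side a * a := by
  unfold side; split_ifs with h <;> linarith

/-- Terms with fewer than two derivatives on the exponential agree on both sides; in the others `f`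
carries at most `k - 2 ≤ r - 3` derivatives and vanishes. -/
theorem leibniz_match_of_vanish {r : ℕ} {f : ℕ → ℝ → ℂ} (α : ℂ)
    (hv : ∀ j, j + 3 ≤ r → f j 0 = 0) {k : ℕ} (hk : k < r) :
    leibniz α 1 f k 0 = leibniz α (-1) f k 0 := by
  refine Finset.sum_congr rfl fun ij hij => ?_
  have := mem_antidiagonal.1 hij
  by_cases h2 : ij.1 < 2
  · rw [dExp_one_sub α h2]
  · rw [hv ij.2 (by omega)]; simp

/-- Compare the formulas at order `j + 2`. Terms with fewer than two derivatives on the exponential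
cancel, those with more than two vanish by induction, and what is left is a nonzero multiple of the
jump times `f j 0`. -/
theorem vanish_of_leibniz_match {r : ℕ} {f : ℕ → ℝ → ℂ} {α : ℂ} (hα : α ≠ 0)
    (hm : ∀ k < r, leibniz α 1 f k 0 = leibniz α (-1) f k 0) :
    ∀ j, j + 3 ≤ r → f j 0 = 0 := by
  intro j
  induction j using Nat.strong_induction_on with
  | _ j ih =>
    intro hj
    have h := hm (j + 2) (by omega)
    rw [leibniz, leibniz, ← sub_eq_zero, ← Finset.sum_sub_distrib,
      Finset.sum_eq_single (2, j)] at h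
    · have h2 : ((j + 2).choose 2 : ℂ) * ((dExp α 1 2 0 - dExp α (-1) 2 0) * f j 0) = 0 := by
        rw [← h]; ring
      rw [dExp_two_sub] at h2
      have hc : ((j + 2).choose 2 : ℂ) ≠ 0 := by
        exact_mod_cast (Nat.choose_pos (by omega)).ne'
      have hp : -(8 * (Real.pi : ℂ) * α) ≠ 0 := by
        simp [hα, Real.pi_ne_zero]
      simpa [hc, hp, hα] using h2
    · intro ij hij hne
      have := mem_antidiagonal.1 hij
      by_cases h2 : ij.1 < 2
      · rw [dExp_one_sub α h2, sub_self]
      · have h3 : ij.1 ≠ 2 := fun h3 => hne (Prod.ext h3 (by simp; omega))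
        rw [ih ij.2 (by omega) (by omega)]; simp
    · intro hne
      exact absurd (mem_antidiagonal.2 (by simp; omega)) hne

/-- Matching values at 0 glue the primitives on the two half-lines, with a single constant of
integration. -/
theorem IsPrimChain.leibniz_side_prim {r : ℕ} {f : ℕ → ℝ → ℂ} (h : IsPrimChain r f) (α : ℂ)
    (hm : ∀ k < r, leibniz α 1 f k 0 = leibniz α (-1) f k 0) {k : ℕ} (hk : k < r) (a : ℝ) :
    leibniz α (side a) f k a = leibniz α 1 f k 0 +
      ∫ s in (0 : ℝ)..a, leibniz α (side s) f (k + 1) s := by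
  rw [(h.leibniz_prim α (side_mul_nonneg a) hk).2]
  have hI : ∫ s in (0 : ℝ)..a, leibniz α (side s) f (k + 1) s =
      ∫ s in (0 : ℝ)..a, leibniz α (side a) f (k + 1) s := by
    refine intervalIntegral.integral_congr_ae ?_
    -- Since `side 0 = 1`, the origin has the wrong side when `a < 0`; it is a null set.
    have h0 : ∀ᵐ s : ℝ, s ≠ 0 := by simp [ae_iff, measure_singleton]
    filter_upwards [h0] with s hs0 hs
    have hs' := Set.uIoc_subset_uIcc hs
    have : side s = side a := by
      rcases Set.mem_uIcc.1 hs' with ⟨h1, h2⟩ | ⟨h1, h2⟩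
      · simp [side, h1, h1.trans h2]
      · have h3 : s < 0 := lt_of_le_of_ne h2 hs0
        simp [side, not_le.2 h3, not_le.2 (h1.trans_lt h3)]
    rw [this]
  rw [hI]
  congr 1
  unfold side
  split_ifs
  · rfl
  · exact (hm k hk).symm

theorem eq_zero_of_integral_eq_zero {h : ℝ → ℂ} {σ : ℝ} (hσ : σ ≠ 0)
    (hc : ∀ a, 0 ≤ σ * a → ContinuousAt h a)
    (hi : ∀ a, 0 ≤ σ * a → IntervalIntegrable h volume 0 a)
    (hz : ∀ a, 0 ≤ σ * a → ∫ s in (0 : ℝ)..a, h s = 0) : ∀ a, 0 ≤ σ * a → h a = 0 := by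
  have hpos : ∀ a, 0 < σ * a → h a = 0 := fun a ha => by
    have hopen : {x : ℝ | 0 < σ * x} ∈ 𝓝 a :=
      (isOpen_lt continuous_const (by fun_prop)).mem_nhds ha
    have hcon : ContinuousOn h {x : ℝ | 0 < σ * x} := fun x hx =>
      (hc x (le_of_lt hx)).continuousWithinAt
    have h1 := intervalIntegral.integral_hasDerivAt_right (hi a ha.le)
      (hcon.stronglyMeasurableAtFilter (isOpen_lt continuous_const (by fun_prop)) a ha)
      (hc a ha.le)
    have h2 : (fun u => ∫ s in (0 : ℝ)..u, h s) =ᶠ[𝓝 a] fun _ => 0 := by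
      filter_upwards [hopen] with x hx using hz x (le_of_lt hx)
    exact h1.unique ((hasDerivAt_const a (0 : ℂ)).congr_of_eventuallyEq h2)
  intro a ha
  rcases ha.lt_or_eq with h1 | h1
  · exact hpos a h1
  · have ha0 : a = 0 := by simpa [hσ] using h1.symm
    subst ha0
    -- The points `σ / (n + 1)` approach the origin from the half-line under consideration.
    have hl : Tendsto (fun n : ℕ => σ * (1 / ((n : ℝ) + 1))) atTop (𝓝 0) := by
      simpa using (tendsto_one_div_add_atTop_nhds_zero_nat (𝕜 := ℝ)).const_mul σ
    have h2 := (hc 0 ha).tendsto.comp hl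
    refine tendsto_nhds_unique h2 (tendsto_const_nhds.congr fun n => ?_)
    refine (hpos _ ?_).symm
    rw [← mul_assoc]
    exact mul_pos (mul_self_pos.2 hσ) (by positivity)

/-- Induction on the order: equal primitives make the integrals of the next difference vanish, and
this difference is continuous because its order is still below `r`. -/
theorem leibniz_eq_of_chain {r : ℕ} {f g : ℕ → ℝ → ℂ} (hf : IsPrimChain r f)
    (hg : IsPrimChain r g) {α : ℂ} {σ : ℝ} (hσ : σ ≠ 0)
    (h0 : ∀ a, 0 ≤ σ * a → leibniz α σ f 0 a = g 0 a) :
    ∀ k < r, ∀ a, 0 ≤ σ * a → leibniz α σ f k a = g k a := by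
  intro k
  induction k with
  | zero => intro _; exact h0
  | succ k ih =>
    intro hk a ha
    have ihk := ih (by omega)
    have key := eq_zero_of_integral_eq_zero (h := fun s => leibniz α σ f (k + 1) s - g (k + 1) s)
      hσ (fun a ha => (hf.continuousAt_leibniz α ha hk).sub (hg.continuous hk).continuousAt)
      (fun a ha => (hf.leibniz_prim α ha (by omega)).1.sub (hg.int _ (by omega) _ _))
      (fun a ha => by
        have h1 := hf.leibniz_prim α ha (k := k) (by omega)
        have h2 := hg.prim k (by omega) a
        rw [intervalIntegral.integral_sub h1.1 (hg.int _ (by omega) _ _)]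
        have h3 := h1.2
        rw [ihk a ha, ihk 0 (by simp)] at h3
        linear_combination h2 - h3) a ha
    exact sub_eq_zero.1 key

/-- If `f 0` and its product with `exp (α a / (1 + 2π|a|))` both have `r` locally integrable
derivatives, then `f 0` vanishes at the origin to order `r - 3`. -/
theorem vanish_of_chain {r : ℕ} {f g : ℕ → ℝ → ℂ} (hf : IsPrimChain r f)
    (hg : IsPrimChain r g) {α : ℂ} (hα : α ≠ 0)
    (h0 : ∀ a, Complex.exp (α * (a * wSide (side a) a : ℝ)) * f 0 a = g 0 a) :
    ∀ j, j + 3 ≤ r → f j 0 = 0 := by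
  have hz : ∀ σ a : ℝ, leibniz α σ f 0 a = Complex.exp (α * (a * wSide σ a : ℝ)) * f 0 a :=
    fun σ a => by simp [leibniz, dExp_zero]
  refine vanish_of_leibniz_match hα fun k hk => ?_
  -- Both one-sided values at the origin equal `g k 0`.
  rw [leibniz_eq_of_chain hf hg one_ne_zero (fun a ha => ?_) k hk 0 (by simp),
    leibniz_eq_of_chain hf hg (neg_ne_zero.2 one_ne_zero) (fun a ha => ?_) k hk 0 (by simp)]
  rotate_left
  · rw [hz, ← h0, side, if_pos (by linarith)]
  · rw [hz, ← h0, side]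
    by_cases ha0 : a = 0
    · simp [ha0]
    · rw [if_neg]
      have := lt_of_le_of_ne (show a ≤ 0 by linarith) ha0
      linarith

/-! ### The propagator on the Fourier side -/

/-- The coefficient `α` for which `symE t = exp (α a w)` on each side of the origin. -/
def alpha (t : ℝ) (ζ : Plane) : ℂ := ((-(2 * Real.pi) * t * eta ζ ^ 2 : ℝ) : ℂ) * Complex.I

theorem one_add_side_pos (a : ℝ) : 1 ≤ 1 + 2 * Real.pi * side a * a := by
  have := mul_nonneg (mul_nonneg zero_le_two Real.pi_pos.le) (side_mul_nonneg a)
  nlinarith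

theorem wSide_side_mem (a : ℝ) : 0 ≤ wSide (side a) a ∧ wSide (side a) a ≤ 1 := by
  have := one_add_side_pos a
  exact ⟨inv_nonneg.2 (by linarith), inv_le_one_of_one_le₀ this⟩

theorem side_mul_self (a : ℝ) : side a * a = |a| := by
  unfold side; split_ifs with h
  · rw [abs_of_nonneg h, one_mul]
  · rw [abs_of_neg (not_le.1 h)]; ring

theorem symE_eq (t : ℝ) (ζ : Plane) :
    symE t ζ = Complex.exp (alpha t ζ * (ζ 0 * wSide (side (ζ 0)) (ζ 0) : ℝ)) := by
  rw [symE, symA_eq, alpha, wSide, show 1 + 2 * Real.pi * side (ζ 0) * ζ 0 =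
    1 + 2 * Real.pi * |ζ 0| by rw [← side_mul_self]; ring, xi, abs_mul, abs_neg,
    abs_of_pos (by positivity : 0 < 2 * Real.pi), div_eq_mul_inv]
  congr 1
  push_cast
  ring

theorem norm_exp_alpha (t x : ℝ) (ζ : Plane) : ‖Complex.exp (alpha t ζ * (x : ℂ))‖ = 1 := by
  rw [alpha, mul_right_comm, ← Complex.ofReal_mul, Complex.norm_exp_ofReal_mul_I]

theorem norm_alpha {t : ℝ} (ht : 0 ≤ t) (ζ : Plane) :
    1 + ‖alpha t ζ‖ ≤ 2 * Real.pi * (1 + t) * lam ζ := by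
  have hπ := Real.pi_gt_three
  rw [alpha, norm_mul, Complex.norm_I, mul_one, Complex.norm_real, Real.norm_eq_abs, abs_mul,
    abs_mul, abs_neg, abs_of_nonneg ht, abs_of_pos (by positivity : 0 < 2 * Real.pi),
    abs_of_nonneg (sq_nonneg _), lam]
  have h1 : 0 ≤ eta ζ ^ 2 := sq_nonneg _
  have h2 : 0 ≤ 2 * Real.pi * eta ζ ^ 2 := by positivity
  have h3 : 0 ≤ 2 * Real.pi * t := by positivity
  nlinarith

/-- The exponential is unimodular and `w` lies in `[0, 1]`, so each derivative of the symbol costs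
only `1 + ‖α‖`, that is, a multiple of `(1 + t)(1 + η²)`. -/
theorem exists_norm_dExp_le : ∃ c : ℕ → ℝ, (∀ i, 0 ≤ c i) ∧ ∀ i t ζ, 0 ≤ t →
    ‖dExp (alpha t ζ) (side (ζ 0)) i (ζ 0)‖ ≤ c i * (1 + t) ^ i * lam ζ ^ i := by
  choose C hC h using fun k => exists_norm_dPoly_le (2 * Real.pi) k
  refine ⟨fun i => C i * (2 * Real.pi) ^ i, fun i => mul_nonneg (hC i) (by positivity),
    fun i t ζ ht => ?_⟩
  rw [dExp, norm_mul, norm_exp_alpha, mul_one]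
  have hβ : ‖((2 * Real.pi * side (ζ 0) : ℝ) : ℂ)‖ ≤ 2 * Real.pi := by
    rw [Complex.norm_real, Real.norm_eq_abs, abs_mul, abs_of_pos (by positivity : 0 < 2 * Real.pi)]
    have : |side (ζ 0)| = 1 := by unfold side; split_ifs <;> simp
    rw [this, mul_one]
  obtain ⟨h0, h1⟩ := wSide_side_mem (ζ 0)
  refine (h i (alpha t ζ) _ hβ _ h0 h1).trans ?_
  calc C i * (1 + ‖alpha t ζ‖) ^ i ≤ C i * (2 * Real.pi * (1 + t) * lam ζ) ^ i := by
        have := hC i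
        have := norm_alpha ht ζ
        gcongr
    _ = _ := by rw [mul_pow, mul_pow]; ring

open Polynomial in
-- Joint continuity in the parameters serves both measurability in `ζ` and continuity in `t` of the
-- derivatives of the symbol.
theorem continuous_coeff_dPoly (k : ℕ) :
    ∀ n, Continuous fun q : ℂ × ℂ => (dPoly q.1 q.2 k).coeff n := by
  induction k with
  | zero => intro n; simp only [dPoly]; exact continuous_const
  | succ k ih =>
    intro n
    simp only [dPoly, coeff_X_pow_mul']
    by_cases hn : 2 ≤ n
    · simp only [if_pos hn, coeff_sub, coeff_C_mul, coeff_derivative]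
      exact (continuous_fst.mul (ih _)).sub
        (continuous_snd.mul ((ih _).mul continuous_const))
    · simp only [if_neg hn]; exact continuous_const

theorem continuous_eval_dPoly (k : ℕ) :
    Continuous fun q : ℂ × ℂ × ℂ => (dPoly q.1 q.2.1 k).eval q.2.2 := by
  have : (fun q : ℂ × ℂ × ℂ => (dPoly q.1 q.2.1 k).eval q.2.2) = fun q =>
      ∑ i ∈ Finset.range (2 * k + 1), (dPoly q.1 q.2.1 k).coeff i * q.2.2 ^ i := by
    funext q
    exact Polynomial.eval_eq_sum_range' (Nat.lt_succ_of_le (natDegree_dPoly_le _ _ k)) _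
  rw [this]
  refine continuous_finsetSum _ fun i _ => ?_
  have h := (continuous_coeff_dPoly k i).comp
    (continuous_fst.prodMk (continuous_fst.comp continuous_snd) : Continuous
      fun q : ℂ × ℂ × ℂ => (q.1, q.2.1))
  exact h.mul ((continuous_snd.comp continuous_snd).pow i)

theorem continuous_alpha (t : ℝ) : Continuous (alpha t) := by
  unfold alpha
  exact (Complex.continuous_ofReal.comp
    (continuous_const.mul (continuous_eta.pow 2))).mul continuous_const

theorem continuous_alpha_left (ζ : Plane) : Continuous fun t => alpha t ζ := by
  unfold alpha; fun_prop

theorem measurable_dExp (t : ℝ) (i : ℕ) :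
    Measurable fun ζ : Plane => dExp (alpha t ζ) (side (ζ 0)) i (ζ 0) := by
  have h0 : Measurable fun ζ : Plane => ζ 0 := by fun_prop
  have hs : Measurable fun ζ : Plane => side (ζ 0) :=
    (Measurable.ite measurableSet_Ici measurable_const measurable_const :
      Measurable side).comp h0
  have hw : Measurable fun ζ : Plane => wSide (side (ζ 0)) (ζ 0) := by
    unfold wSide; fun_prop
  have ha := (continuous_alpha t).measurable
  unfold dExp
  have h1 := (continuous_eval_dPoly i).measurable.comp (ha.prodMk
    ((Complex.measurable_ofReal.comp (hs.const_mul (2 * Real.pi))).prodMk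
      (Complex.measurable_ofReal.comp hw)))
  exact h1.mul (ha.mul (Complex.measurable_ofReal.comp (h0.mul hw))).cexp

theorem continuous_dExp_left (ζ : Plane) (i : ℕ) :
    Continuous fun t => dExp (alpha t ζ) (side (ζ 0)) i (ζ 0) := by
  unfold dExp
  have ha := continuous_alpha_left ζ
  exact ((continuous_eval_dPoly i).comp (ha.prodMk (continuous_const.prodMk continuous_const))).mul
    (ha.mul continuous_const).cexp

/-- The Leibniz formula for the `k`-th derivative of `symE t * F 0`. -/
def leibnizE (t : ℝ) (F : ℕ → L2) (k : ℕ) (ζ : Plane) : ℂ :=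
  ∑ ij ∈ antidiagonal k,
    (k.choose ij.1 : ℂ) * (dExp (alpha t ζ) (side (ζ 0)) ij.1 (ζ 0) * F ij.2 ζ)

theorem leibnizE_zero (t : ℝ) (F : ℕ → L2) (ζ : Plane) :
    leibnizE t F 0 ζ = symE t ζ * F 0 ζ := by
  simp [leibnizE, dExp_zero, symE_eq]

theorem stronglyMeasurable_leibnizE (t : ℝ) (F : ℕ → L2) (k : ℕ) :
    StronglyMeasurable (leibnizE t F k) := by
  refine Measurable.stronglyMeasurable ?_
  unfold leibnizE
  refine Finset.measurable_sum _ fun ij _ => ?_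
  exact ((measurable_dExp t ij.1).mul (Lp.stronglyMeasurable _).measurable).const_mul _

theorem continuous_leibnizE_left (F : ℕ → L2) (k : ℕ) (ζ : Plane) :
    Continuous fun t => leibnizE t F k ζ := by
  unfold leibnizE
  exact continuous_finsetSum _ fun ij _ =>
    continuous_const.mul ((continuous_dExp_left ζ ij.1).mul continuous_const)

/-! ### L² bounds for the Leibniz formula -/

/-- The norm that controls all the terms of the Leibniz formula. -/
def chainNorm (r : ℕ) (F : ℕ → L2) : ℝ≥0∞ :=
  eLpNorm (fun ζ => (((2 * lam ζ) ^ r : ℝ) : ℂ) * F 0 ζ) 2 (volume : Measure Plane) +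
    eLpNorm (F r) 2 (volume : Measure Plane)

theorem aestronglyMeasurable_lam_pow (i : ℕ) (f : L2) :
    AEStronglyMeasurable (fun ζ => ((lam ζ ^ i : ℝ) : ℂ) * f ζ) volume :=
  (Complex.continuous_ofReal.comp (continuous_lam.pow i)).aestronglyMeasurable.mul
    (Lp.aestronglyMeasurable f)

theorem IsXiChain.eLpNorm_lam_pow {r : ℕ} {F : ℕ → L2} (h : IsXiChain r F) {i j : ℕ}
    (hij : i + j ≤ r) :
    eLpNorm (fun ζ => ((lam ζ ^ i : ℝ) : ℂ) * F j ζ) 2 (volume : Measure Plane) ≤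
      chainNorm r F := by
  have := h.lintegral_lam_pow hij
  rw [← eLpNorm_two_sq, ← eLpNorm_two_sq, ← eLpNorm_two_sq] at this
  rw [← ENNReal.pow_le_pow_left_iff two_ne_zero, chainNorm, add_sq]
  refine this.trans ?_
  rw [add_right_comm]
  exact le_self_add

/-- A majorant of `leibnizE t F k`, up to the factor `(1 + t) ^ k`. -/
def leibnizDom (c : ℕ → ℝ) (F : ℕ → L2) (k : ℕ) (ζ : Plane) : ℝ :=
  ∑ ij ∈ antidiagonal k, k.choose ij.1 * c ij.1 * ‖((lam ζ ^ ij.1 : ℝ) : ℂ) * F ij.2 ζ‖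

theorem norm_leibnizE_le {c : ℕ → ℝ} (hc0 : ∀ i, 0 ≤ c i) (hc : ∀ i t ζ, 0 ≤ t →
      ‖dExp (alpha t ζ) (side (ζ 0)) i (ζ 0)‖ ≤ c i * (1 + t) ^ i * lam ζ ^ i)
    {t : ℝ} (ht : 0 ≤ t) (F : ℕ → L2) (k : ℕ) (ζ : Plane) :
    ‖leibnizE t F k ζ‖ ≤ (1 + t) ^ k * leibnizDom c F k ζ := by
  rw [leibnizE, leibnizDom, Finset.mul_sum]
  refine (norm_sum_le _ _).trans (Finset.sum_le_sum fun ij hij => ?_)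
  have hik : ij.1 ≤ k := by have := mem_antidiagonal.1 hij; omega
  have hl := (lam_pos ζ).le
  have hci := hc0 ij.1
  rw [norm_mul, norm_mul, norm_mul, Complex.norm_natCast, Complex.norm_real,
    Real.norm_of_nonneg (by positivity)]
  calc (k.choose ij.1 : ℝ) * (‖dExp (alpha t ζ) (side (ζ 0)) ij.1 (ζ 0)‖ * ‖F ij.2 ζ‖)
      ≤ k.choose ij.1 * ((c ij.1 * (1 + t) ^ ij.1 * lam ζ ^ ij.1) * ‖F ij.2 ζ‖) := by
        gcongr; exact hc _ _ _ ht
    _ ≤ k.choose ij.1 * ((c ij.1 * (1 + t) ^ k * lam ζ ^ ij.1) * ‖F ij.2 ζ‖) := by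
        gcongr; linarith
    _ = _ := by ring

theorem aestronglyMeasurable_leibnizDom (c : ℕ → ℝ) (F : ℕ → L2) (k : ℕ) :
    AEStronglyMeasurable (leibnizDom c F k) volume := by
  unfold leibnizDom
  refine Finset.aestronglyMeasurable_fun_sum _ fun ij _ => ?_
  exact (aestronglyMeasurable_lam_pow _ _).norm.const_mul _

theorem IsXiChain.eLpNorm_leibnizDom_le {r : ℕ} {F : ℕ → L2} (h : IsXiChain r F) {c : ℕ → ℝ}
    (hc0 : ∀ i, 0 ≤ c i) {k : ℕ} (hk : k ≤ r) :
    eLpNorm (leibnizDom c F k) 2 (volume : Measure Plane) ≤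
      ENNReal.ofReal (∑ ij ∈ antidiagonal k, k.choose ij.1 * c ij.1) * chainNorm r F := by
  have e : leibnizDom c F k = ∑ ij ∈ antidiagonal k, fun ζ =>
      (k.choose ij.1 * c ij.1 : ℝ) • ‖((lam ζ ^ ij.1 : ℝ) : ℂ) * F ij.2 ζ‖ := by
    funext ζ; simp [leibnizDom]
  have hm : ∀ ij : ℕ × ℕ, AEStronglyMeasurable (fun ζ =>
      (k.choose ij.1 * c ij.1 : ℝ) • ‖((lam ζ ^ ij.1 : ℝ) : ℂ) * F ij.2 ζ‖) volume := fun ij =>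
    (aestronglyMeasurable_lam_pow ij.1 (F ij.2)).norm.const_mul _
  rw [e]
  refine (eLpNorm_sum_le (fun ij _ => hm ij) (by norm_num)).trans ?_
  rw [ENNReal.ofReal_sum_of_nonneg fun ij _ => mul_nonneg (Nat.cast_nonneg _) (hc0 _),
    Finset.sum_mul]
  refine Finset.sum_le_sum fun ij hij => ?_
  have := mem_antidiagonal.1 hij
  have hnn : 0 ≤ (k.choose ij.1 * c ij.1 : ℝ) := mul_nonneg (Nat.cast_nonneg _) (hc0 _)
  have e2 := eLpNorm_const_smul (k.choose ij.1 * c ij.1 : ℝ)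
    (fun ζ => ‖((lam ζ ^ ij.1 : ℝ) : ℂ) * F ij.2 ζ‖) 2 (volume : Measure Plane)
  rw [← ofReal_norm, Real.norm_of_nonneg hnn, eLpNorm_norm] at e2
  refine (le_of_eq e2).trans ?_
  gcongr
  exact h.eLpNorm_lam_pow (by omega)

theorem IsXiChain.memLp_leibnizDom {r : ℕ} {F : ℕ → L2} (h : IsXiChain r F) {c : ℕ → ℝ}
    (hc0 : ∀ i, 0 ≤ c i) (hn : chainNorm r F ≠ ∞) {k : ℕ} (hk : k ≤ r) :
    MemLp (leibnizDom c F k) 2 (volume : Measure Plane) :=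
  ⟨aestronglyMeasurable_leibnizDom c F k, (h.eLpNorm_leibnizDom_le hc0 hk).trans_lt
    (ENNReal.mul_lt_top ENNReal.ofReal_lt_top hn.lt_top)⟩

theorem IsXiChain.memLp_leibnizE {r : ℕ} {F : ℕ → L2} (h : IsXiChain r F)
    (hn : chainNorm r F ≠ ∞) {k : ℕ} (hk : k ≤ r) {t : ℝ} (ht : 0 ≤ t) :
    MemLp (leibnizE t F k) 2 (volume : Measure Plane) := by
  obtain ⟨c, hc0, hc⟩ := exists_norm_dExp_le
  exact ((h.memLp_leibnizDom hc0 hn hk).const_mul ((1 + t) ^ k)).of_le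
    (stronglyMeasurable_leibnizE t F k).aestronglyMeasurable (Eventually.of_forall fun ζ =>
      (norm_leibnizE_le hc0 hc ht F k ζ).trans (le_abs_self _))

theorem exists_eLpNorm_leibnizE_le (r : ℕ) : ∃ K : ℝ, 0 ≤ K ∧ ∀ F : ℕ → L2, IsXiChain r F →
    ∀ t : ℝ, 0 ≤ t → eLpNorm (leibnizE t F r) 2 (volume : Measure Plane) ≤
      ENNReal.ofReal ((1 + t) ^ r * K) * chainNorm r F := by
  obtain ⟨c, hc0, hc⟩ := exists_norm_dExp_le
  refine ⟨∑ ij ∈ antidiagonal r, r.choose ij.1 * c ij.1,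
    Finset.sum_nonneg fun ij _ => mul_nonneg (Nat.cast_nonneg _) (hc0 _), fun F h t ht => ?_⟩
  have h1 : eLpNorm (leibnizE t F r) 2 (volume : Measure Plane) ≤
      eLpNorm (fun ζ => ((1 + t) ^ r : ℝ) • leibnizDom c F r ζ) 2 (volume : Measure Plane) :=
    eLpNorm_mono fun ζ => (norm_leibnizE_le hc0 hc ht F r ζ).trans (le_abs_self _)
  have e2 := eLpNorm_const_smul ((1 + t) ^ r : ℝ) (leibnizDom c F r) 2 (volume : Measure Plane)
  rw [← ofReal_norm, Real.norm_of_nonneg (by positivity)] at e2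
  refine (h1.trans (le_of_eq e2)).trans ?_
  rw [ENNReal.ofReal_mul (by positivity), mul_assoc]
  gcongr
  exact h.eLpNorm_leibnizDom_le hc0 le_rfl

/-! ### Fibers of a chain -/

/-- `f` is a chain of primitives representing the restriction of the chain `F` to the line with
second coordinate `b`. -/
def IsFiber (r : ℕ) (F : ℕ → L2) (b : ℝ) (f : ℕ → ℝ → ℂ) : Prop :=
  IsPrimChain r f ∧ ∀ k ≤ r, ∀ᵐ a, f k a = F k (pt a b)

theorem IsXiChain.ae_exists_isFiber {r : ℕ} {F : ℕ → L2} (h : IsXiChain r F) :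
    ∀ᵐ b : ℝ, ∃ f, IsFiber r F b f := by
  have h' : ∀ᵐ b : ℝ, ∀ k, k < r → ∃ c : ℂ, ∀ᵐ a : ℝ,
      F k (pt a b) = c + ∫ s in (0 : ℝ)..a, F (k + 1) (pt s b) := by
    rw [ae_all_iff]
    intro k
    by_cases hk : k < r
    · filter_upwards [h k hk] with b hb _ using hb
    · exact Eventually.of_forall fun b hk' => absurd hk' hk
  filter_upwards [h', ae_all_iff.2 fun k => ae_memLp_fiber (Lp.memLp (F k))] with b hb hL
  choose! c hc using hb
  -- Below order `r` the primitive itself is taken, which makes the equation hold at every point;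
  -- the top order needs no better representative.
  set f : ℕ → ℝ → ℂ := fun k a =>
    if k < r then c k + ∫ s in (0 : ℝ)..a, F (k + 1) (pt s b) else F k (pt a b) with hf
  have hae : ∀ k, ∀ᵐ a, f k a = F k (pt a b) := fun k => by
    by_cases hk : k < r
    · filter_upwards [hc k hk] with a ha
      rw [hf]; simp only [if_pos hk]; exact ha.symm
    · exact Eventually.of_forall fun a => by rw [hf]; simp only [if_neg hk]
  refine ⟨f, ⟨fun k _ a b' => ?_, fun k hk x => ?_⟩, fun k _ => hae k⟩
  · refine (intervalIntegrable_of_memLp (hL k) a b').congr_ae ?_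
    exact ae_restrict_of_ae ((hae k).mono fun a ha => ha.symm)
  · have : ∫ s in (0 : ℝ)..x, f (k + 1) s = ∫ s in (0 : ℝ)..x, F (k + 1) (pt s b) :=
      intervalIntegral.integral_congr_ae ((hae (k + 1)).mono fun s hs _ => hs)
    rw [this]
    simp [hf, hk]

/-- Vanishing of the derivatives of order at most `r - 3` on the line `ξ = 0`. -/
def VanishesAtZero (r : ℕ) (F : ℕ → L2) : Prop :=
  -- Written as `j + 3 ≤ r` because truncated subtraction in `j ≤ r - 3` would still demand `j = 0`
  -- when `r < 3`.
  ∀ᵐ b : ℝ, ∀ f, IsFiber r F b f → ∀ j, j + 3 ≤ r → f j 0 = 0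

theorem alpha_pt (t a b : ℝ) : alpha t (pt a b) = alpha t (pt 0 b) := rfl

theorem leibnizE_pt {r : ℕ} {F : ℕ → L2} {b : ℝ} {f : ℕ → ℝ → ℂ} (hf : IsFiber r F b f) (t : ℝ)
    {k : ℕ} (hk : k ≤ r) : ∀ᵐ a : ℝ,
      leibnizE t F k (pt a b) = leibniz (alpha t (pt 0 b)) (side a) f k a := by
  have h : ∀ᵐ a : ℝ, ∀ j, j ≤ r → f j a = F j (pt a b) := by
    rw [ae_all_iff]
    intro j
    by_cases hj : j ≤ r
    · filter_upwards [hf.2 j hj] with a ha _ using ha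
    · exact Eventually.of_forall fun a hj' => absurd hj' hj
  filter_upwards [h] with a ha
  refine Finset.sum_congr rfl fun ij hij => ?_
  have := mem_antidiagonal.1 hij
  rw [ha ij.2 (by omega), pt_zero, alpha_pt]

/-- On almost every line the vanishing condition makes the one-sided formulas match, so they glue to
primitives; finiteness of `chainNorm` puts every order in L². -/
theorem IsXiChain.leibnizE_chain {r : ℕ} {F : ℕ → L2} (h : IsXiChain r F)
    (hn : chainNorm r F ≠ ∞) (hv : VanishesAtZero r F) {t : ℝ} (ht : 0 ≤ t) :
    IsXiChain r fun k => toL2 (leibnizE t F k) := by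
  intro k hk
  have hx : HasXiDeriv (leibnizE t F k) (leibnizE t F (k + 1)) := by
    filter_upwards [h.ae_exists_isFiber, hv] with b ⟨f, hf⟩ hvb
    refine ⟨leibniz (alpha t (pt 0 b)) 1 f k 0, ?_⟩
    filter_upwards [leibnizE_pt hf t hk.le] with a ha
    rw [ha, hf.1.leibniz_side_prim (alpha t (pt 0 b))
      (fun k hk => leibniz_match_of_vanish _ (hvb f hf) hk) hk a]
    congr 1
    exact intervalIntegral.integral_congr_ae
      ((leibnizE_pt hf t hk).mono fun s hs _ => hs.symm)
  exact hx.congr (toL2_ae (h.memLp_leibnizE hn hk.le ht)).symm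
    (toL2_ae (h.memLp_leibnizE hn hk ht)).symm

theorem toL2_leibnizE_zero {r : ℕ} {F : ℕ → L2} (h : IsXiChain r F)
    (hn : chainNorm r F ≠ ∞) {φ : L2} (hφ : F 0 = 𝓕 φ) {t : ℝ} (ht : 0 ≤ t) :
    (𝓕⁻ (toL2 (leibnizE t F 0)) : L2) = E t φ := by
  rw [E]
  refine congrArg (fun f : L2 => (𝓕⁻ f : L2)) (Lp.ext ?_)
  filter_upwards [toL2_ae (h.memLp_leibnizE hn (Nat.zero_le r) ht),
    (memLp_symE_mul t (𝓕 φ : L2)).coeFn_toLp] with ζ h1 h2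
  rw [h1, h2, leibnizE_zero, hφ]

/-- The weight `x ^ r` on `E t φ` corresponds to the Leibniz formula. -/
theorem IsXiChain.xMul_E {r : ℕ} {F : ℕ → L2} (h : IsXiChain r F)
    (hn : chainNorm r F ≠ ∞) (hv : VanishesAtZero r F) {φ : L2} (hφ : F 0 = 𝓕 φ) {t : ℝ}
    (ht : 0 ≤ t) :
    (𝓕⁻ (toL2 (leibnizE t F r)) : L2) =ᵐ[volume] fun p => xMul p ^ r * E t φ p := by
  have := (h.leibnizE_chain hn hv ht).fourierInv r le_rfl
  rwa [toL2_leibnizE_zero h hn hφ ht] at this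

theorem eLpNorm_fourierInv (f : L2) :
    eLpNorm (𝓕⁻ f : L2) 2 (volume : Measure Plane) = eLpNorm f 2 (volume : Measure Plane) := by
  rw [← Lp.enorm_def, ← Lp.enorm_def, enorm_fourierInv]

theorem eLpNorm_fourier (f : L2) :
    eLpNorm (𝓕 f : L2) 2 (volume : Measure Plane) = eLpNorm f 2 (volume : Measure Plane) := by
  rw [← Lp.enorm_def, ← Lp.enorm_def, enorm_fourier]

theorem IsXiChain.eLpNorm_xMul_E {r : ℕ} {F : ℕ → L2} (h : IsXiChain r F)
    (hn : chainNorm r F ≠ ∞) (hv : VanishesAtZero r F) {φ : L2} (hφ : F 0 = 𝓕 φ) {t : ℝ}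
    (ht : 0 ≤ t) :
    eLpNorm (fun p => xMul p ^ r * E t φ p) 2 (volume : Measure Plane) =
      eLpNorm (leibnizE t F r) 2 (volume : Measure Plane) := by
  rw [← eLpNorm_congr_ae (h.xMul_E hn hv hφ ht), eLpNorm_fourierInv,
    eLpNorm_congr_ae (toL2_ae (h.memLp_leibnizE hn le_rfl ht))]

theorem IsXiChain.eLpNorm_xMul_E_sub {r : ℕ} {F : ℕ → L2} (h : IsXiChain r F)
    (hn : chainNorm r F ≠ ∞) (hv : VanishesAtZero r F) {φ : L2} (hφ : F 0 = 𝓕 φ) {t t₀ : ℝ}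
    (ht : 0 ≤ t) (ht₀ : 0 ≤ t₀) :
    eLpNorm (fun p => xMul p ^ r * (E t φ - E t₀ φ : L2) p) 2 (volume : Measure Plane) =
      eLpNorm (fun ζ => leibnizE t F r ζ - leibnizE t₀ F r ζ) 2 (volume : Measure Plane) := by
  set G : L2 := toL2 (leibnizE t F r)
  set G₀ : L2 := toL2 (leibnizE t₀ F r)
  have e1 : (fun p => xMul p ^ r * (E t φ - E t₀ φ : L2) p) =ᵐ[volume] (𝓕⁻ (G - G₀) : L2) := by
    have : (𝓕⁻ (G - G₀) : L2) = 𝓕⁻ G - 𝓕⁻ G₀ :=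
      (Lp.fourierTransformₗᵢ Plane ℂ).symm.map_sub G G₀
    rw [this]
    filter_upwards [h.xMul_E hn hv hφ ht, h.xMul_E hn hv hφ ht₀, Lp.coeFn_sub (E t φ) (E t₀ φ),
      Lp.coeFn_sub (𝓕⁻ G : L2) (𝓕⁻ G₀)] with p h1 h2 h3 h4
    rw [h3, h4, Pi.sub_apply, Pi.sub_apply, h1, h2]
    ring
  have e2 : (fun ζ => leibnizE t F r ζ - leibnizE t₀ F r ζ) =ᵐ[volume] (G - G₀ : L2) := by
    filter_upwards [toL2_ae (h.memLp_leibnizE hn le_rfl ht),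
      toL2_ae (h.memLp_leibnizE hn le_rfl ht₀), Lp.coeFn_sub G G₀] with p h1 h2 h3
    rw [h3, Pi.sub_apply, h1, h2]
  rw [eLpNorm_congr_ae e1, eLpNorm_congr_ae e2, eLpNorm_fourierInv]

/-! ### Norm estimates -/

theorem measurable_sobolevWeight (s₁ s₂ : ℝ) : Measurable (sobolevWeight s₁ s₂) := by
  have h1 := continuous_xi.measurable
  have h2 := continuous_eta.measurable
  unfold sobolevWeight
  exact (measurable_const.add ((measurable_norm.comp h1).pow_const s₁)).add
    ((measurable_norm.comp h2).pow_const s₂)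

theorem one_le_sobolevWeight (s₁ s₂ : ℝ) (ζ : Plane) : 1 ≤ sobolevWeight s₁ s₂ ζ := by
  have h1 := Real.rpow_nonneg (abs_nonneg (xi ζ)) s₁
  have h2 := Real.rpow_nonneg (abs_nonneg (eta ζ)) s₂
  unfold sobolevWeight
  linarith

theorem norm_sobolevWeight (s₁ s₂ : ℝ) (ζ : Plane) :
    ‖(sobolevWeight s₁ s₂ ζ : ℂ)‖ = sobolevWeight s₁ s₂ ζ := by
  rw [Complex.norm_real, Real.norm_of_nonneg (by linarith [one_le_sobolevWeight s₁ s₂ ζ])]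

/-- The hypothesis `s₂ ≥ 2r` enters here: `(1 + η²)^r` is absorbed by `|η|^{s₂}` where `|η| ≥ 1`,
and by the summand 1 elsewhere. -/
theorem two_mul_lam_pow_le {r : ℕ} {s₁ s₂ : ℝ} (hs : 2 * (r : ℝ) ≤ s₂) (ζ : Plane) :
    (2 * lam ζ) ^ r ≤ 4 ^ r * sobolevWeight s₁ s₂ ζ := by
  have h1 := Real.rpow_nonneg (abs_nonneg (xi ζ)) s₁
  have h2 := Real.rpow_nonneg (abs_nonneg (eta ζ)) s₂
  have hl := (lam_pos ζ).le
  rcases le_total |eta ζ| 1 with h | h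
  · have : lam ζ ≤ 2 := by
      unfold lam
      nlinarith [sq_abs (eta ζ), abs_nonneg (eta ζ)]
    calc (2 * lam ζ) ^ r ≤ 4 ^ r := by gcongr; linarith
      _ ≤ _ := le_mul_of_one_le_right (by positivity) (one_le_sobolevWeight _ _ _)
  · have h3 : lam ζ ≤ 2 * |eta ζ| ^ 2 := by
      unfold lam
      nlinarith [sq_abs (eta ζ), abs_nonneg (eta ζ)]
    calc (2 * lam ζ) ^ r ≤ (2 * (2 * |eta ζ| ^ 2)) ^ r := by gcongr
      _ = 4 ^ r * |eta ζ| ^ (2 * (r : ℝ)) := by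
        rw [← mul_assoc, mul_pow, ← pow_mul]
        norm_num
        rw [← Real.rpow_natCast]
        push_cast
        rfl
      _ ≤ 4 ^ r * |eta ζ| ^ s₂ := by
        gcongr
      _ ≤ _ := by
        gcongr
        unfold sobolevWeight
        linarith

/-- The `L²` norm defining `normH`, with values in `[0, ∞]`. -/
def eNormH (s₁ s₂ : ℝ) (φ : L2) : ℝ≥0∞ :=
  eLpNorm (fun ζ => (sobolevWeight s₁ s₂ ζ : ℂ) * (𝓕 φ : L2) ζ) 2 (volume : Measure Plane)

/-- The `L²` norm defining `normWeighted r 0`, with values in `[0, ∞]`. -/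
def eNormW (r : ℕ) (φ : L2) : ℝ≥0∞ :=
  eLpNorm (fun p => ((|p 0| ^ (r : ℝ) + |p 1| ^ (0 : ℝ) : ℝ) : ℂ) * φ p) 2
    (volume : Measure Plane)

theorem memH_iff {s₁ s₂ : ℝ} {φ : L2} : MemH s₁ s₂ φ ↔ eNormH s₁ s₂ φ < ∞ :=
  ⟨fun h => h.2, fun h => ⟨(Complex.measurable_ofReal.comp
    (measurable_sobolevWeight s₁ s₂)).aestronglyMeasurable.mul (Lp.aestronglyMeasurable _), h⟩⟩

theorem memWeighted_iff {r : ℕ} {φ : L2} : MemWeighted r 0 φ ↔ eNormW r φ < ∞ := by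
  refine ⟨fun h => h.2, fun h => ⟨?_, h⟩⟩
  simp only [weight_eq]
  have : Continuous fun p : Plane => ((|p 0| ^ r + 1 : ℝ) : ℂ) := by fun_prop
  exact this.aestronglyMeasurable.mul (Lp.aestronglyMeasurable _)

theorem eLpNorm_le_eNormH (s₁ s₂ : ℝ) (φ : L2) :
    eLpNorm φ 2 (volume : Measure Plane) ≤ eNormH s₁ s₂ φ := by
  rw [← eLpNorm_fourier]
  refine eLpNorm_mono fun ζ => ?_
  rw [norm_mul, norm_sobolevWeight]
  exact le_mul_of_one_le_left (norm_nonneg _) (one_le_sobolevWeight _ _ _)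

theorem eNormW_le (r : ℕ) (φ : L2) :
    eNormW r φ ≤ eLpNorm (fun p => xMul p ^ r * φ p) 2 (volume : Measure Plane) +
      eLpNorm φ 2 (volume : Measure Plane) := by
  have h1 : AEStronglyMeasurable (fun p : Plane => ‖xMul p ^ r * φ p‖) volume :=
    ((continuous_xMul.pow r).aestronglyMeasurable.mul (Lp.aestronglyMeasurable φ)).norm
  have h2 : AEStronglyMeasurable (fun p : Plane => ‖φ p‖) volume :=
    (Lp.aestronglyMeasurable φ).norm
  have h3 := eLpNorm_add_le h1 h2 (p := 2) (by norm_num)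
  rw [eLpNorm_norm, eLpNorm_norm] at h3
  refine le_trans (eLpNorm_mono fun p => ?_) h3
  rw [weight_eq, norm_mul, Complex.norm_real, Real.norm_of_nonneg (by positivity),
    Pi.add_apply, Real.norm_of_nonneg (by positivity), norm_mul, norm_pow, norm_xMul, add_mul,
    one_mul]
  have hπ := Real.pi_gt_three
  have : |p 0| ≤ 2 * Real.pi * |p 0| := le_mul_of_one_le_left (abs_nonneg _) (by linarith)
  gcongr

theorem eLpNorm_xMul_le (r : ℕ) (φ : L2) :
    eLpNorm (fun p => xMul p ^ r * φ p) 2 (volume : Measure Plane) ≤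
      ENNReal.ofReal ((2 * Real.pi) ^ r) * eNormW r φ := by
  refine eLpNorm_le_mul_eLpNorm_of_ae_le_mul (Eventually.of_forall fun p => ?_) 2
  rw [weight_eq, norm_mul, norm_mul, norm_pow, norm_xMul, Complex.norm_real,
    Real.norm_of_nonneg (by positivity), mul_pow, mul_assoc]
  gcongr
  linarith

theorem eLpNorm_le_eNormW (r : ℕ) (φ : L2) :
    eLpNorm φ 2 (volume : Measure Plane) ≤ eNormW r φ := by
  refine eLpNorm_mono fun p => ?_
  rw [weight_eq, norm_mul, Complex.norm_real, Real.norm_of_nonneg (by positivity)]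
  refine le_mul_of_one_le_left (norm_nonneg _) ?_
  linarith [pow_nonneg (abs_nonneg (p 0)) r]

theorem chainNorm_fourierChain_le {r : ℕ} {s₁ s₂ : ℝ} (hs : 2 * (r : ℝ) ≤ s₂) {φ : L2}
    (hφ : MemWeighted r 0 φ) : chainNorm r (fourierChain φ) ≤
      ENNReal.ofReal (4 ^ r) * eNormH s₁ s₂ φ +
        ENNReal.ofReal ((2 * Real.pi) ^ r) * eNormW r φ := by
  refine add_le_add ?_ ?_
  · rw [fourierChain_zero]
    refine eLpNorm_le_mul_eLpNorm_of_ae_le_mul (Eventually.of_forall fun ζ => ?_) 2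
    have := (lam_pos ζ).le
    rw [norm_mul, norm_mul, norm_sobolevWeight, Complex.norm_real,
      Real.norm_of_nonneg (by positivity), ← mul_assoc]
    gcongr
    exact two_mul_lam_pow_le hs ζ
  · rw [fourierChain, eLpNorm_fourier, eLpNorm_congr_ae (xPow_ae hφ le_rfl)]
    exact eLpNorm_xMul_le r φ

theorem chainNorm_ne_top {r : ℕ} {s₁ s₂ : ℝ} (hs : 2 * (r : ℝ) ≤ s₂) {φ : L2}
    (hφ : MemF s₁ s₂ r 0 φ) : chainNorm r (fourierChain φ) ≠ ∞ :=
  ((chainNorm_fourierChain_le (s₁ := s₁) hs hφ.2).trans_lt (ENNReal.add_lt_top.2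
    ⟨ENNReal.mul_lt_top ENNReal.ofReal_lt_top hφ.1.2,
      ENNReal.mul_lt_top ENNReal.ofReal_lt_top hφ.2.2⟩)).ne

theorem eNormH_E (s₁ s₂ t : ℝ) (φ : L2) : eNormH s₁ s₂ (E t φ) = eNormH s₁ s₂ φ := by
  refine eLpNorm_congr_norm_ae ?_
  filter_upwards [fourier_E t φ] with ζ h
  rw [h, norm_mul, norm_mul, norm_mul, norm_symE, one_mul]

theorem exists_eNormW_E_le (r : ℕ) : ∃ K : ℝ, 0 ≤ K ∧ ∀ s₁ s₂ : ℝ, 2 * (r : ℝ) ≤ s₂ →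
    ∀ φ : L2, MemF s₁ s₂ r 0 φ → VanishesAtZero r (fourierChain φ) → ∀ t : ℝ, 0 ≤ t →
      eNormW r (E t φ) ≤ ENNReal.ofReal ((1 + t) ^ r * K) * (eNormH s₁ s₂ φ + eNormW r φ) := by
  obtain ⟨K, hK, h⟩ := exists_eLpNorm_leibnizE_le r
  -- The first summand bounds the Leibniz term through `chainNorm`; the 1 pays for the conserved L²
  -- norm.
  refine ⟨K * (4 ^ r + (2 * Real.pi) ^ r) + 1, by positivity, fun s₁ s₂ hs φ hφ hv t ht => ?_⟩
  have hch := isXiChain_fourierChain hφ.2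
  have hn := chainNorm_ne_top hs hφ
  have hE : eLpNorm (E t φ) 2 (volume : Measure Plane) ≤ eNormW r φ := by
    refine le_trans (le_of_eq ?_) (eLpNorm_le_eNormW r φ)
    rw [← eLpNorm_fourier, ← eLpNorm_fourier φ]
    refine eLpNorm_congr_norm_ae ?_
    filter_upwards [fourier_E t φ] with ζ h
    rw [h, norm_mul, norm_symE, one_mul]
  have h1 := eNormW_le r (E t φ)
  rw [hch.eLpNorm_xMul_E hn hv (fourierChain_zero φ) ht] at h1
  have h2 : chainNorm r (fourierChain φ) ≤
      ENNReal.ofReal (4 ^ r + (2 * Real.pi) ^ r) * (eNormH s₁ s₂ φ + eNormW r φ) := by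
    refine (chainNorm_fourierChain_le (s₁ := s₁) hs hφ.2).trans ?_
    rw [mul_add]
    gcongr
    · exact le_add_of_nonneg_right (by positivity)
    · exact le_add_of_nonneg_left (by positivity)
  have hp : (1 : ℝ) ≤ (1 + t) ^ r := one_le_pow₀ (by linarith)
  calc eNormW r (E t φ)
      ≤ ENNReal.ofReal ((1 + t) ^ r * K) *
          (ENNReal.ofReal (4 ^ r + (2 * Real.pi) ^ r) * (eNormH s₁ s₂ φ + eNormW r φ)) +
        ENNReal.ofReal ((1 + t) ^ r) * (eNormH s₁ s₂ φ + eNormW r φ) := by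
        refine h1.trans (add_le_add ((h _ hch t ht).trans (by gcongr)) (hE.trans ?_))
        calc eNormW r φ ≤ eNormH s₁ s₂ φ + eNormW r φ := le_add_self
          _ ≤ _ := le_mul_of_one_le_left zero_le (by simpa using ENNReal.ofReal_le_ofReal hp)
    _ = _ := by
        rw [← mul_assoc, ← ENNReal.ofReal_mul (by positivity), ← add_mul,
          ← ENNReal.ofReal_add (by positivity) (by positivity)]
        congr 2
        ring

theorem memF_E {r : ℕ} {s₁ s₂ : ℝ} (hs : 2 * (r : ℝ) ≤ s₂) {φ : L2} (hφ : MemF s₁ s₂ r 0 φ)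
    (hv : VanishesAtZero r (fourierChain φ)) {t : ℝ} (ht : 0 ≤ t) : MemF s₁ s₂ r 0 (E t φ) := by
  obtain ⟨K, -, h⟩ := exists_eNormW_E_le r
  refine ⟨memH_iff.2 ?_, memWeighted_iff.2 ((h s₁ s₂ hs φ hφ hv t ht).trans_lt ?_)⟩
  · rw [eNormH_E]; exact hφ.1.2
  · exact ENNReal.mul_lt_top ENNReal.ofReal_lt_top (ENNReal.add_lt_top.2 ⟨hφ.1.2, hφ.2.2⟩)

theorem exists_normF_E_le (r : ℕ) : ∃ K : ℝ, 0 < K ∧ ∀ s₁ s₂ : ℝ, 2 * (r : ℝ) ≤ s₂ →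
    ∀ φ : L2, MemF s₁ s₂ r 0 φ → VanishesAtZero r (fourierChain φ) → ∀ t : ℝ, 0 ≤ t →
      normF s₁ s₂ r 0 (E t φ) ≤ K * (1 + t) ^ r * normF s₁ s₂ r 0 φ := by
  obtain ⟨K, hK, h⟩ := exists_eNormW_E_le r
  -- `K` comes from the weighted part, 1 from the invariant Sobolev part, and 2 from bounding the
  -- sum of the two norms by twice `normF`.
  refine ⟨2 * (K + 1), by positivity, fun s₁ s₂ hs φ hφ hv t ht => ?_⟩
  have h1 := h s₁ s₂ hs φ hφ hv t ht
  have hHt : normH s₁ s₂ (E t φ) = normH s₁ s₂ φ := congrArg ENNReal.toReal (eNormH_E s₁ s₂ t φ)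
  have hW : normWeighted r 0 (E t φ) ≤
      (1 + t) ^ r * K * (normH s₁ s₂ φ + normWeighted r 0 φ) := by
    have h2 := ENNReal.toReal_mono (ENNReal.mul_lt_top ENNReal.ofReal_lt_top
      (ENNReal.add_lt_top.2 ⟨hφ.1.2, hφ.2.2⟩)).ne h1
    rw [ENNReal.toReal_mul, ENNReal.toReal_ofReal (by positivity),
      ENNReal.toReal_add hφ.1.2.ne hφ.2.2.ne] at h2
    exact h2
  have hp : (1 : ℝ) ≤ (1 + t) ^ r := one_le_pow₀ (by linarith)
  have hH0 : 0 ≤ normH s₁ s₂ φ := ENNReal.toReal_nonneg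
  have hW0 : 0 ≤ normWeighted r 0 φ := ENNReal.toReal_nonneg
  have hWt0 : 0 ≤ normWeighted r 0 (E t φ) := ENNReal.toReal_nonneg
  have hsum : normH s₁ s₂ φ + normWeighted r 0 φ ≤ 2 * normF s₁ s₂ r 0 φ := by
    have a1 : normH s₁ s₂ φ ≤ normF s₁ s₂ r 0 φ :=
      Real.le_sqrt_of_sq_le (le_add_of_nonneg_right (sq_nonneg _))
    have a2 : normWeighted r 0 φ ≤ normF s₁ s₂ r 0 φ :=
      Real.le_sqrt_of_sq_le (le_add_of_nonneg_left (sq_nonneg _))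
    linarith
  calc normF s₁ s₂ r 0 (E t φ) ≤ normH s₁ s₂ φ + normWeighted r 0 (E t φ) := by
        rw [normF, hHt]
        refine Real.sqrt_le_iff.2 ⟨by positivity, ?_⟩
        nlinarith
    _ ≤ (1 + t) ^ r * (normH s₁ s₂ φ + normWeighted r 0 φ) +
        (1 + t) ^ r * K * (normH s₁ s₂ φ + normWeighted r 0 φ) := by
        refine add_le_add ?_ hW
        nlinarith
    _ = (K + 1) * (1 + t) ^ r * (normH s₁ s₂ φ + normWeighted r 0 φ) := by ring
    _ ≤ (K + 1) * (1 + t) ^ r * (2 * normF s₁ s₂ r 0 φ) := by gcongr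
    _ = _ := by ring

/-! ### Continuity in time -/

theorem tendsto_eLpNorm_zero_of_dominated {l : Filter ℝ} [l.IsCountablyGenerated]
    {f : ℝ → Plane → ℂ} {g : Plane → ℝ} (hf : ∀ t, StronglyMeasurable (f t))
    (hb : ∀ᶠ t in l, ∀ ζ, ‖f t ζ‖ ≤ g ζ) (hg : MemLp g 2 (volume : Measure Plane))
    (hlim : ∀ ζ, Tendsto (fun t => f t ζ) l (𝓝 0)) :
    Tendsto (fun t => eLpNorm (f t) 2 (volume : Measure Plane)) l (𝓝 0) := by
  have hg2 : ∫⁻ ζ, ‖(g ζ : ℂ)‖ₑ ^ 2 ≠ ∞ := by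
    rw [← eLpNorm_two_sq]
    have : eLpNorm (fun ζ => (g ζ : ℂ)) 2 (volume : Measure Plane) =
        eLpNorm g 2 (volume : Measure Plane) :=
      eLpNorm_congr_norm_ae (Eventually.of_forall fun ζ => Complex.norm_real _)
    rw [this]
    exact (ENNReal.pow_lt_top hg.2).ne
  have h := tendsto_lintegral_filter_of_dominated_convergence (μ := (volume : Measure Plane))
    (l := l) (F := fun t ζ => ‖f t ζ‖ₑ ^ 2) (f := fun _ => 0)
    (fun ζ => ‖(g ζ : ℂ)‖ₑ ^ 2)
    (Eventually.of_forall fun t => (hf t).measurable.enorm.pow_const 2)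
    (hb.mono fun t ht => Eventually.of_forall fun ζ => by
      gcongr
      rw [← ofReal_norm, ← ofReal_norm, Complex.norm_real]
      exact ENNReal.ofReal_le_ofReal ((ht ζ).trans (le_abs_self _)))
    hg2 (Eventually.of_forall fun ζ => by
      have := ENNReal.Tendsto.pow (n := 2) (hlim ζ).enorm
      simpa using this)
  rw [lintegral_zero] at h
  have h4 := (ENNReal.continuous_rpow_const (y := (1 / 2 : ℝ))).tendsto 0 |>.comp h
  have h5 : (0 : ℝ≥0∞) ^ (1 / 2 : ℝ) = 0 := by simp
  rw [h5] at h4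
  refine h4.congr fun t => ?_
  rw [Function.comp_apply, ← eLpNorm_two_sq, ← ENNReal.rpow_natCast, ← ENNReal.rpow_mul]
  norm_num

theorem tendsto_eNormH_E_sub {s₁ s₂ : ℝ} {φ : L2} (hφ : MemH s₁ s₂ φ) (t₀ : ℝ) {l : Filter ℝ}
    [l.IsCountablyGenerated] (hl : l ≤ 𝓝 t₀) :
    Tendsto (fun t => eNormH s₁ s₂ (E t φ - E t₀ φ)) l (𝓝 0) := by
  have h : ∀ t, eNormH s₁ s₂ (E t φ - E t₀ φ) = eLpNorm (fun ζ =>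
      (symE t ζ - symE t₀ ζ) * ((sobolevWeight s₁ s₂ ζ : ℂ) * (𝓕 φ : L2) ζ)) 2
      (volume : Measure Plane) := fun t => by
    refine eLpNorm_congr_ae ?_
    have : (𝓕 (E t φ - E t₀ φ) : L2) = 𝓕 (E t φ) - 𝓕 (E t₀ φ) :=
      (Lp.fourierTransformₗᵢ Plane ℂ).map_sub _ _
    rw [this]
    filter_upwards [fourier_E t φ, fourier_E t₀ φ, Lp.coeFn_sub (𝓕 (E t φ) : L2) (𝓕 (E t₀ φ))]
      with ζ h1 h2 h3
    rw [h3, Pi.sub_apply, h1, h2]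
    ring
  simp only [h]
  refine tendsto_eLpNorm_zero_of_dominated
    (g := fun ζ => 2 * ‖(sobolevWeight s₁ s₂ ζ : ℂ) * (𝓕 φ : L2) ζ‖) (fun t => ?_)
    (Eventually.of_forall fun t ζ => ?_) (hφ.norm.const_mul 2) fun ζ => ?_
  · exact ((continuous_symE t).sub (continuous_symE t₀)).stronglyMeasurable.mul
      ((Complex.measurable_ofReal.comp (measurable_sobolevWeight s₁ s₂)).stronglyMeasurable.mul
        (Lp.stronglyMeasurable _))
  · rw [norm_mul]
    gcongr
    refine (norm_sub_le _ _).trans ?_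
    rw [norm_symE, norm_symE]
    norm_num
  · have hc : Continuous fun t => symE t ζ := by unfold symE; fun_prop
    have h1 : Tendsto (fun t => symE t ζ) l (𝓝 (symE t₀ ζ)) := (hc.tendsto t₀).mono_left hl
    have := (h1.sub_const (symE t₀ ζ)).mul_const
      ((sobolevWeight s₁ s₂ ζ : ℂ) * (𝓕 φ : L2) ζ)
    simpa using this

theorem IsXiChain.tendsto_leibnizE_sub {r : ℕ} {F : ℕ → L2} (h : IsXiChain r F)
    (hn : chainNorm r F ≠ ∞) {t₀ : ℝ} (ht₀ : 0 ≤ t₀) :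
    Tendsto (fun t => eLpNorm (fun ζ => leibnizE t F r ζ - leibnizE t₀ F r ζ) 2
      (volume : Measure Plane)) (𝓝[Set.Ici 0] t₀) (𝓝 0) := by
  obtain ⟨c, hc0, hc⟩ := exists_norm_dExp_le
  refine tendsto_eLpNorm_zero_of_dominated
    -- For `t < t₀ + 1`, both `(1 + t) ^ r` and `(1 + t₀) ^ r` are at most `(2 + t₀) ^ r`.
    (g := fun ζ => 2 * (2 + t₀) ^ r * leibnizDom c F r ζ) (fun t => ?_) ?_
    ((h.memLp_leibnizDom hc0 hn le_rfl).const_mul _) fun ζ => ?_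
  · exact (stronglyMeasurable_leibnizE t F r).sub (stronglyMeasurable_leibnizE t₀ F r)
  · have h1 : ∀ᶠ t in 𝓝[Set.Ici 0] t₀, t < t₀ + 1 :=
      nhdsWithin_le_nhds (gt_mem_nhds (by linarith))
    filter_upwards [h1, self_mem_nhdsWithin] with t ht1 ht0 ζ
    have hd : 0 ≤ leibnizDom c F r ζ := Finset.sum_nonneg fun ij _ =>
      mul_nonneg (mul_nonneg (Nat.cast_nonneg _) (hc0 _)) (norm_nonneg _)
    have h0 : (0 : ℝ) ≤ t := ht0
    calc ‖leibnizE t F r ζ - leibnizE t₀ F r ζ‖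
        ≤ (1 + t) ^ r * leibnizDom c F r ζ + (1 + t₀) ^ r * leibnizDom c F r ζ :=
          (norm_sub_le _ _).trans (add_le_add (norm_leibnizE_le hc0 hc ht0 F r ζ)
            (norm_leibnizE_le hc0 hc ht₀ F r ζ))
      _ ≤ (2 + t₀) ^ r * leibnizDom c F r ζ + (2 + t₀) ^ r * leibnizDom c F r ζ := by
          gcongr ?_ ^ r * _ + ?_ ^ r * _ <;> linarith
      _ = _ := by ring
  · have h1 := ((continuous_leibnizE_left F r ζ).tendsto t₀).mono_left
      (nhdsWithin_le_nhds (s := Set.Ici 0))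
    simpa using h1.sub_const (leibnizE t₀ F r ζ)

theorem isContinuousCurve_E {r : ℕ} {s₁ s₂ : ℝ} (hs : 2 * (r : ℝ) ≤ s₂) {φ : L2}
    (hφ : MemF s₁ s₂ r 0 φ) (hv : VanishesAtZero r (fourierChain φ)) :
    IsContinuousCurve s₁ s₂ r 0 fun t => E t φ := by
  refine ⟨fun t ht => memF_E hs hφ hv ht, fun t₀ ht₀ => ?_⟩
  have hch := isXiChain_fourierChain hφ.2
  have hn := chainNorm_ne_top hs hφ
  have hH := tendsto_eNormH_E_sub hφ.1 t₀ (l := 𝓝[Set.Ici 0] t₀) nhdsWithin_le_nhds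
  have hW : Tendsto (fun t => eNormW r (E t φ - E t₀ φ)) (𝓝[Set.Ici 0] t₀) (𝓝 0) := by
    have h0 := (hch.tendsto_leibnizE_sub hn ht₀).add hH
    rw [add_zero] at h0
    refine tendsto_of_tendsto_of_tendsto_of_le_of_le' tendsto_const_nhds h0
      (Eventually.of_forall fun _ => zero_le) ?_
    filter_upwards [self_mem_nhdsWithin] with t ht
    rw [← hch.eLpNorm_xMul_E_sub hn hv (fourierChain_zero φ) ht ht₀]
    exact (eNormW_le r _).trans (add_le_add le_rfl (eLpNorm_le_eNormH s₁ s₂ _))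
  have hH' := (ENNReal.tendsto_toReal ENNReal.zero_ne_top).comp hH
  have hW' := (ENNReal.tendsto_toReal ENNReal.zero_ne_top).comp hW
  have := ((hH'.pow 2).add (hW'.pow 2)).sqrt
  simp only [ENNReal.toReal_zero, ne_eq, OfNat.ofNat_ne_zero, not_false_eq_true, zero_pow,
    add_zero, Real.sqrt_zero] at this
  exact this

/-! ### Representatives of class `C^k` on lines -/

theorem IsPrimChain.hasDerivAt {r : ℕ} {f : ℕ → ℝ → ℂ} (h : IsPrimChain r f) {k : ℕ}
    (hk : k + 1 < r) (x : ℝ) : HasDerivAt (f k) (f (k + 1) x) x := by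
  have hc := h.continuous hk
  rw [show f k = fun x => f k 0 + ∫ s in (0 : ℝ)..x, f (k + 1) s from funext (h.prim k (by omega))]
  exact (intervalIntegral.integral_hasDerivAt_right (hc.intervalIntegrable 0 x)
    (hc.stronglyMeasurableAtFilter _ _) hc.continuousAt).const_add _

theorem IsPrimChain.contDiff {r : ℕ} {f : ℕ → ℝ → ℂ} (h : IsPrimChain r f) (n : ℕ) :
    ∀ k, k + n < r → ContDiff ℝ n (f k) := by
  induction n with
  | zero => intro k hk; exact contDiff_zero.2 (h.continuous (by omega))
  | succ n ih =>
    intro k hk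
    have hd : ∀ x, HasDerivAt (f k) (f (k + 1) x) x := h.hasDerivAt (by omega)
    push_cast
    refine contDiff_succ_iff_deriv.2 ⟨fun x => (hd x).differentiableAt, by simp, ?_⟩
    rw [show deriv (f k) = f (k + 1) from funext fun x => (hd x).deriv]
    exact ih (k + 1) (by omega)

theorem IsPrimChain.iteratedDeriv_scaled {r : ℕ} {f : ℕ → ℝ → ℂ} (h : IsPrimChain r f) (d : ℂ)
    (c : ℝ) : ∀ j, j < r →
      iteratedDeriv j (fun x => d * f 0 (c * x)) = fun x => d * (c : ℂ) ^ j * f j (c * x) := by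
  intro j
  induction j with
  | zero => intro _; simp
  | succ j ih =>
    intro hj
    rw [iteratedDeriv_succ, ih (by omega)]
    funext x
    have h1 : HasDerivAt (fun x : ℝ => c * x) c x := by
      simpa using (hasDerivAt_id x).const_mul c
    have h2 := ((h.hasDerivAt hj (c * x)).scomp x h1).const_mul (d * (c : ℂ) ^ j)
    rw [show (fun x => d * (c : ℂ) ^ j * f j (c * x)) =
      fun x => d * (c : ℂ) ^ j * (f j ∘ fun x => c * x) x from rfl, h2.deriv, Complex.real_smul]
    ring

theorem ae_comp_mul_left {c : ℝ} (hc : c ≠ 0) {P : ℝ → Prop} (h : ∀ᵐ x, P x) :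
    ∀ᵐ x, P (c * x) := by
  rw [ae_iff] at h ⊢
  have := Real.volume_preimage_mul_left hc {x | ¬P x}
  rw [h, mul_zero] at this
  exact this

/-- The value at the origin of the continuous representative of `F` with derivative `F₁`. -/
def initialValue (F F₁ : L2) (b : ℝ) : ℂ :=
  -- On a good line the integrand is almost everywhere the constant value at 0; averaging selects it
  -- measurably in `b`. Rescaling the inner integral fixes its limits, so measurability in the
  -- parameters follows from Fubini.
  ∫ s in (0 : ℝ)..1, (F (pt s b) - s * ∫ u in (0 : ℝ)..1, F₁ (pt (s * u) b))

/-- The representative of `F` that is continuous on almost every horizontal line, where `F₁` is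
the weak derivative of `F`. -/
def continuousRep (F F₁ : L2) (a b : ℝ) : ℂ :=
  initialValue F F₁ b + a * ∫ u in (0 : ℝ)..1, F₁ (pt (a * u) b)

theorem stronglyMeasurable_scaledIntegral (F₁ : L2) :
    StronglyMeasurable fun q : ℝ × ℝ => (q.2 : ℂ) * ∫ u in (0 : ℝ)..1, F₁ (pt (q.2 * u) q.1) := by
  have h1 : StronglyMeasurable fun w : (ℝ × ℝ) × ℝ => F₁ (pt (w.1.2 * w.2) w.1.1) :=
    (Lp.stronglyMeasurable F₁).comp_measurable (g := fun w : (ℝ × ℝ) × ℝ =>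
      pt (w.1.2 * w.2) w.1.1) (measurable_pt.comp (f := fun w : (ℝ × ℝ) × ℝ =>
        (w.1.1, w.1.2 * w.2)) (by fun_prop))
  have h2 := h1.integral_prod_right' (ν := volume.restrict (Set.Ioc (0 : ℝ) 1))
  simp only [intervalIntegral.integral_of_le zero_le_one]
  exact ((Complex.measurable_ofReal.comp measurable_snd).stronglyMeasurable).mul h2

theorem stronglyMeasurable_initialValue (F F₁ : L2) :
    StronglyMeasurable (initialValue F F₁) := by
  have h1 : StronglyMeasurable fun q : ℝ × ℝ =>
      F (pt q.2 q.1) - q.2 * ∫ u in (0 : ℝ)..1, F₁ (pt (q.2 * u) q.1) :=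
    ((Lp.stronglyMeasurable F).comp_measurable measurable_pt).sub
      (stronglyMeasurable_scaledIntegral F₁)
  have h2 := h1.integral_prod_right' (ν := volume.restrict (Set.Ioc (0 : ℝ) 1))
  unfold initialValue
  simp only [intervalIntegral.integral_of_le zero_le_one] at h2 ⊢
  exact h2

theorem stronglyMeasurable_continuousRep (F F₁ : L2) :
    StronglyMeasurable fun ζ : Plane => continuousRep F F₁ (ζ 0) (ζ 1) := by
  have h0 : Measurable fun ζ : Plane => (ζ 1, ζ 0) := by fun_prop
  have h1 : Measurable fun ζ : Plane => ζ 1 := by fun_prop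
  exact ((stronglyMeasurable_initialValue F F₁).comp_measurable h1).add
    ((stronglyMeasurable_scaledIntegral F₁).comp_measurable h0)

theorem mul_integral_scaled (g : ℝ → ℂ) (a : ℝ) :
    (a : ℂ) * ∫ u in (0 : ℝ)..1, g (a * u) = ∫ s in (0 : ℝ)..a, g s := by
  have := intervalIntegral.smul_integral_comp_mul_left (a := 0) (b := 1) g a
  rw [mul_zero, mul_one, Complex.real_smul] at this
  exact this

theorem IsFiber.continuousRep_eq {r : ℕ} (hr : 0 < r) {F : ℕ → L2} {b : ℝ} {f : ℕ → ℝ → ℂ}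
    (hf : IsFiber r F b f) (a : ℝ) : continuousRep (F 0) (F 1) a b = f 0 a := by
  have hI : ∀ a : ℝ, (a : ℂ) * ∫ u in (0 : ℝ)..1, F 1 (pt (a * u) b) =
      ∫ s in (0 : ℝ)..a, f 1 s := fun a => by
    rw [mul_integral_scaled fun s => F 1 (pt s b)]
    exact intervalIntegral.integral_congr_ae ((hf.2 1 hr).mono fun s hs _ => hs.symm)
  have h0 : initialValue (F 0) (F 1) b = f 0 0 := by
    have : initialValue (F 0) (F 1) b = ∫ _ in (0 : ℝ)..1, f 0 0 := by
      refine intervalIntegral.integral_congr_ae ((hf.2 0 hr.le).mono fun s hs _ => ?_)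
      rw [← hs, hI, hf.1.prim 0 hr s]
      ring
    rw [this]; simp
  rw [continuousRep, h0, hI, hf.1.prim 0 hr a]

/-- Fibers are chosen line by line, with no measurability in `b`. The explicit `continuousRep`
agrees with them on almost every line and is measurable, so equality on lines becomes equality
almost everywhere in the plane. -/
theorem exists_isFiberwiseRep {r : ℕ} (hr : 3 ≤ r) {φ : L2} (hφ : MemWeighted r 0 φ) :
    ∃ h : ℝ → ℝ → ℂ, IsFiberwiseRep (r - 3) φ h := by
  set F := fourierChain φ with hF
  have hπ : (2 * Real.pi) ≠ 0 := by positivity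
  have hfib := (isXiChain_fourierChain hφ).ae_exists_isFiber
  set c : ℝ := (-(2 * Real.pi))⁻¹ with hc
  have hc0 : c ≠ 0 := inv_ne_zero (neg_ne_zero.2 hπ)
  refine ⟨fun ξ η => ((2 * Real.pi : ℝ) : ℂ)⁻¹ * continuousRep (F 0) (F 1) (c * ξ) (c * η),
    ?_, ?_⟩
  · have key : ∀ᵐ ζ : Plane, continuousRep (F 0) (F 1) (ζ 0) (ζ 1) = F 0 ζ := by
      refine ae_of_ae_ae (measurableSet_eq_fun
        (stronglyMeasurable_continuousRep _ _).measurable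
        (Lp.stronglyMeasurable (F 0)).measurable).nullMeasurableSet ?_
      filter_upwards [hfib] with b ⟨f, hf⟩
      filter_upwards [hf.2 0 (Nat.zero_le r)] with a ha
      rw [pt_zero, pt_one, hf.continuousRep_eq (by omega), ha]
    filter_upwards [key] with ζ hζ
    have e : ∀ x : ℝ, c * (-(2 * Real.pi) * x) = x := fun x => by
      rw [hc, ← mul_assoc, inv_mul_cancel₀ (neg_ne_zero.2 hπ), one_mul]
    change _ * continuousRep (F 0) (F 1) (c * (-(2 * Real.pi) * ζ 0))
      (c * (-(2 * Real.pi) * ζ 1)) = _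
    rw [e, e, hat, hζ, hF, fourierChain_zero]
  · filter_upwards [ae_comp_mul_left hc0 hfib] with η ⟨f, hf⟩
    rw [show (fun ξ => ((2 * Real.pi : ℝ) : ℂ)⁻¹ * continuousRep (F 0) (F 1) (c * ξ) (c * η)) =
      fun ξ => ((2 * Real.pi : ℝ) : ℂ)⁻¹ * f 0 (c * ξ) from
      funext fun ξ => congrArg _ (hf.continuousRep_eq (by omega) _)]
    exact contDiff_const.mul ((hf.1.contDiff (r - 3) 0 (by omega)).comp
      (contDiff_const.mul contDiff_id))

/-- On almost every line both sides are continuous and agree almost everywhere, hence everywhere.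
The values at `ξ = 0` thus do not depend on the representative. -/
theorem IsFiberwiseRep.eq_fiber {r : ℕ} (hr : 3 ≤ r) {φ : L2}
    {h : ℝ → ℝ → ℂ} (hh : IsFiberwiseRep (r - 3) φ h) :
    ∀ᵐ b : ℝ, ∀ f, IsFiber r (fourierChain φ) b f → ∀ ξ : ℝ,
      h ξ (-(2 * Real.pi) * b) =
        ((2 * Real.pi : ℝ) : ℂ)⁻¹ * f 0 ((-(2 * Real.pi))⁻¹ * ξ) := by
  have hπ : -(2 * Real.pi) ≠ 0 := neg_ne_zero.2 (by positivity)
  filter_upwards [ae_ae_of_ae hh.1, ae_comp_mul_left hπ hh.2] with b hb hcd f hf ξ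
  have hae : (fun a : ℝ => h (-(2 * Real.pi) * a) (-(2 * Real.pi) * b)) =ᵐ[volume]
      fun a => ((2 * Real.pi : ℝ) : ℂ)⁻¹ * f 0 a := by
    filter_upwards [hb, hf.2 0 (Nat.zero_le r)] with a h1 h2
    rw [h2, fourierChain_zero]
    exact h1
  have hc1 : Continuous fun a : ℝ => h (-(2 * Real.pi) * a) (-(2 * Real.pi) * b) :=
    hcd.continuous.comp (continuous_const.mul continuous_id)
  have hc2 : Continuous fun a => ((2 * Real.pi : ℝ) : ℂ)⁻¹ * f 0 a :=
    continuous_const.mul (hf.1.continuous (by omega))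
  have := congrFun ((Continuous.ae_eq_iff_eq volume hc1 hc2).1 hae) ((-(2 * Real.pi))⁻¹ * ξ)
  simpa only [mul_inv_cancel_left₀ hπ] using this

theorem IsFiberwiseRep.vanish_iff {r : ℕ} (hr : 3 ≤ r) {φ : L2} (hφ : MemWeighted r 0 φ)
    {h : ℝ → ℝ → ℂ} (hh : IsFiberwiseRep (r - 3) φ h) :
    (∀ᵐ η : ℝ, ∀ j ≤ r - 3, iteratedDeriv j (fun ξ => h ξ η) 0 = 0) ↔
      VanishesAtZero r (fourierChain φ) := by
  have hπ : -(2 * Real.pi) ≠ 0 := neg_ne_zero.2 (by positivity)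
  have key : ∀ᵐ b : ℝ, ∀ f, IsFiber r (fourierChain φ) b f → ∀ j, j < r →
      (iteratedDeriv j (fun ξ => h ξ (-(2 * Real.pi) * b)) 0 = 0 ↔ f j 0 = 0) := by
    filter_upwards [hh.eq_fiber hr] with b hb f hf j hj
    rw [show (fun ξ => h ξ (-(2 * Real.pi) * b)) = _ from funext (hb f hf),
      hf.1.iteratedDeriv_scaled _ _ j hj]
    simp [Real.pi_ne_zero]
  constructor
  · intro hv
    filter_upwards [key, ae_comp_mul_left hπ hv] with b hb hvb f hf j hj
    exact (hb f hf j (by omega)).1 (hvb j (by omega))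
  · intro hv
    have h1 : ∀ᵐ b : ℝ, ∀ j ≤ r - 3,
        iteratedDeriv j (fun ξ => h ξ (-(2 * Real.pi) * b)) 0 = 0 := by
      filter_upwards [key, hv, (isXiChain_fourierChain hφ).ae_exists_isFiber]
        with b hb hvb ⟨f, hf⟩ j hj
      exact (hb f hf j (by omega)).2 (hvb f hf j (by omega))
    filter_upwards [ae_comp_mul_left (inv_ne_zero hπ) h1] with η hη
    simpa only [mul_inv_cancel_left₀ hπ] using hη

/-! ### Necessity of the vanishing condition -/

theorem continuous_pt_left (b : ℝ) : Continuous fun a => pt a b := by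
  have h : ∀ a, pt a b = EuclideanSpace.single 0 a + EuclideanSpace.single 1 b := fun a => by
    ext i; fin_cases i <;> simp [pt]
  have h2 : Continuous fun a : ℝ => (EuclideanSpace.single (0 : Fin 2) a : Plane) := by
    have : (fun a : ℝ => (EuclideanSpace.single (0 : Fin 2) a : Plane)) =
        fun a => a • EuclideanSpace.single (0 : Fin 2) 1 := by
      funext a; ext i; fin_cases i <;> simp
    rw [this]; fun_prop
  simp only [h]
  exact h2.add continuous_const

/-- The single time `t = 1` suffices: off the null line `b = 0` the coefficient `α` is nonzero, and
the fibers of `φ` and `E 1 φ` are two chains related by the symbol. -/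
theorem vanishesAtZero_of_memWeighted {r : ℕ} (hr : 0 < r) {φ : L2}
    (hE : MemWeighted r 0 (E 1 φ)) : VanishesAtZero r (fourierChain φ) := by
  have hb0 : ∀ᵐ b : ℝ, b ≠ 0 := by simp [ae_iff, measure_singleton]
  filter_upwards [hb0, (isXiChain_fourierChain hE).ae_exists_isFiber,
    ae_ae_of_ae (fourier_E 1 φ)] with b hb ⟨g, hg⟩ hbE f hf
  have hα : alpha 1 (pt 0 b) ≠ 0 := by
    simp [alpha, eta, hb, Real.pi_ne_zero]
  have hs : ∀ a, symE 1 (pt a b) =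
      Complex.exp (alpha 1 (pt 0 b) * (a * wSide (side a) a : ℝ)) := fun a => by
    rw [symE_eq, alpha_pt, pt_zero]
  refine vanish_of_chain hf.1 hg.1 hα ?_
  have hae : (fun a => symE 1 (pt a b) * f 0 a) =ᵐ[volume] g 0 := by
    filter_upwards [hbE, hf.2 0 (Nat.zero_le r), hg.2 0 (Nat.zero_le r)] with a h1 h2 h3
    rw [h2, h3, fourierChain_zero, fourierChain_zero, h1]
  have := (Continuous.ae_eq_iff_eq volume
    (((continuous_symE 1).comp (continuous_pt_left b)).mul (hf.1.continuous hr))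
    (hg.1.continuous hr)).1 hae
  intro a
  rw [← hs]
  exact congrFun this a

end RZKBO

end

/-! ### The main theorem -/

theorem mainTheorem3 (r : ℕ) :
    ((r = 1 ∨ r = 2) →
      ∃ P : Polynomial ℝ, P.natDegree = r ∧ (∀ i ≤ r, 0 < P.coeff i) ∧
        ∀ s₁ s₂ : ℝ, 2 * (r : ℝ) ≤ s₂ →
          ∀ φ : RZKBO.L2, RZKBO.MemF s₁ s₂ r 0 φ →
            ∀ t : ℝ, 0 ≤ t →
              RZKBO.MemF s₁ s₂ r 0 (RZKBO.E t φ) ∧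
              RZKBO.normF s₁ s₂ r 0 (RZKBO.E t φ) ≤ P.eval t * RZKBO.normF s₁ s₂ r 0 φ) ∧
    (3 ≤ r →
      ∀ s₁ s₂ : ℝ, 2 * (r : ℝ) ≤ s₂ →
        ∀ φ : RZKBO.L2, RZKBO.MemF s₁ s₂ r 0 φ →
          (∃ h : ℝ → ℝ → ℂ, RZKBO.IsFiberwiseRep (r - 3) φ h) ∧
          ∀ h : ℝ → ℝ → ℂ, RZKBO.IsFiberwiseRep (r - 3) φ h →
            (RZKBO.IsContinuousCurve s₁ s₂ r 0 (fun t => RZKBO.E t φ) ↔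
              ∀ᵐ η : ℝ, ∀ j ≤ r - 3, iteratedDeriv j (fun ξ => h ξ η) 0 = 0)) := by
  refine ⟨fun hr => ?_, fun hr s₁ s₂ hs φ hφ =>
    ⟨RZKBO.exists_isFiberwiseRep hr hφ.2, fun h hh => ?_⟩⟩
  · obtain ⟨K, hK, hKE⟩ := RZKBO.exists_normF_E_le r
    -- The binomial expansion of the growth bound `K (1 + t)^r` has positive coefficients.
    refine ⟨Polynomial.C K * (1 + Polynomial.X) ^ r, ?_, fun i hi => ?_,
      fun s₁ s₂ hs φ hφ t ht => ?_⟩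
    · rw [Polynomial.natDegree_C_mul hK.ne', add_comm, ← Polynomial.C_1,
        Polynomial.natDegree_pow_X_add_C]
    · rw [Polynomial.coeff_C_mul, Polynomial.coeff_one_add_X_pow]
      exact mul_pos hK (by exact_mod_cast Nat.choose_pos hi)
    · have hv : RZKBO.VanishesAtZero r (RZKBO.fourierChain φ) :=
        -- No `j` satisfies `j + 3 ≤ r` when `r ≤ 2`.
        Eventually.of_forall fun b f _ j hj => by omega
      refine ⟨RZKBO.memF_E hs hφ hv ht, ?_⟩
      simpa using hKE s₁ s₂ hs φ hφ hv t ht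
  · rw [hh.vanish_iff hr hφ.2]
    exact ⟨fun hc => RZKBO.vanishesAtZero_of_memWeighted (by omega)
      (hc.1 1 zero_le_one).2, RZKBO.isContinuousCurve_E hs hφ⟩
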